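/- Let $\mathfrak m\subset\mathbb C[[x,y_1,y_2]]$ be the ideal of formal power series with null constant term. Consider formal vector fields $Y=b\,\partial_x+b_1\partial_{y_1}+b_2\partial_{y_2}$ with $b,b_1,b_2\in\mathfrak m$, and the group of formal diffeomorphisms $\Phi$ of $(\mathbb C^3,0)$, acting by $\Phi_*(Y)=(\mathrm D\Phi\cdot Y)\circ\Phi^{-1}$. Put $\omega=\frac{dy_1\wedge dy_2}{x}$ and let $\langle dx\rangle$ be the ideal generated by $dx$ in the exterior algebra of formal differential forms. - $Y$ is *transversally Hamiltonian* if $\mathcal L_Y(dx)\in\langle dx\rangle$ and $x\,\mathcal L_Y(\omega)\in\langle dx\rangle$. - $\Phi$ is *transversally symplectic* if $\Phi^*(x)=x$ and $x\,\Phi^*(\omega)\in x\omega+\langle dx\rangle$. These $\Phi$ form a group $\widehat{\mathrm{Diff}}_\omega$. - $\widehat{\mathcal{SN}}_\omega$, the set of *transversally Hamiltonian doubly-resonant saddle-nodes*, is the set of transversally Hamiltonian $Y$ that are $\widehat{\mathrm{Diff}}_\omega$-conjugate to a vector field $x^2\partial_x+(-\lambda y_1+F_1)\partial_{y_1}+(\lambda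 y_2+F_2)\partial_{y_2}$ with $\lambda\in\mathbb C^*$ and $F_1,F_2\in\mathfrak m^2$. For $p=(\lambda,(a_1,a_2),c)\in\mathcal P_\omega:=\mathbb C^*\times\{(a_1,a_2)\in\mathbb C^2: a_1+a_2=1\}\times v\mathbb C[[v]]$, put $$Z_p=x^2\partial_x+\bigl(-\lambda+a_1x-c(y_1y_2)\bigr)y_1\partial_{y_1}+\bigl(\lambda+a_2x+c(y_1y_2)\bigr)y_2\partial_{y_2}.$$ Then: 1. $Z_p\in\widehat{\mathcal{SN}}_\omega$ for every $p\in\mathcal P_\omega$. 2. Every $Y\in\widehat{\mathcal{SN}}_\omega$ is $\widehat{\mathrm{Diff}}_\omega$-conjugate to $Z_p$ for some $p\in\mathcal P_\omega$. 3. $Z_p$ and $Z_q$ are $\widehat{\mathrm{Diff}}_\omega$-conjugate if and only if $q=p$ or $q=\sigma(p)$, where $\sigma(\lambda,(a_1,a_2),c(v))=(-\lambda,(a_2,a_1),-c(-v))$. 4. There exists a bijection $$\widehat{\mathcal{SN}}_\omega/\widehat{\mathrm{Diff}}_\omega\;\simeq\;\mathbb C^*\times\{(a_1,a_2)\in\mathbb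 C^2: a_1+a_2=1\}\times v\mathbb C[[v]]$$ with the following property: for every $Y\in\widehat{\mathcal{SN}}_\omega$ and every $(\lambda,(a_1,a_2),c)\in\mathcal P_\omega$ with $-\frac\pi2<\arg\lambda\le\frac\pi2$, the class of $Y$ is sent to $(\lambda^2,(a_1,a_2),c)$ if and only if $Y$ is $\widehat{\mathrm{Diff}}_\omega$-conjugate to $Z_{(\lambda,(a_1,a_2),c)}$. -/

import Mathlib

namespace SaddleNode

noncomputable section

/-- The algebra `ℂ⟦x, y₁, y₂⟧` of formal power series. -/
abbrev FormalSeries : Type := MvPowerSeries (Fin 3) ℂ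

/-- The coordinate `x`. -/
def x : FormalSeries := MvPowerSeries.X 0

/-- The coordinate `y₁`. -/
def y₁ : FormalSeries := MvPowerSeries.X 1

/-- The coordinate `y₂`. -/
def y₂ : FormalSeries := MvPowerSeries.X 2

/-- The maximal ideal `𝔪`: formal power series with null constant term. -/
def 𝔪 : Ideal FormalSeries :=
  RingHom.ker (MvPowerSeries.constantCoeff (σ := Fin 3) (R := ℂ))

/-! ### Formal vector fields and formal diffeomorphisms -/

/-- Formal vector fields at the origin of `ℂ³`, seen as derivations of `ℂ⟦x, y₁, y₂⟧`: the
derivation `Y` is the Lie derivative `ℒ_Y`, and its components are `Y x`, `Y y₁`, `Y y₂`. -/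
abbrev VectorField : Type := Derivation ℂ FormalSeries FormalSeries

/-- The vector field `b ∂/∂x + b₁ ∂/∂y₁ + b₂ ∂/∂y₂`. -/
def ofComponents (b b₁ b₂ : FormalSeries) : VectorField :=
  b • MvPowerSeries.pderiv ℂ 0 + b₁ • MvPowerSeries.pderiv ℂ 1 + b₂ • MvPowerSeries.pderiv ℂ 2

/-- `Y` vanishes at the origin: its three components lie in `𝔪`. -/
def IsSingular (Y : VectorField) : Prop := Y x ∈ 𝔪 ∧ Y y₁ ∈ 𝔪 ∧ Y y₂ ∈ 𝔪

/-- Formal diffeomorphisms fixing the origin of `ℂ³`, seen as algebra automorphisms of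
`ℂ⟦x, y₁, y₂⟧`: a diffeomorphism is identified with its pull-back `Φ^* : f ↦ f ∘ Φ`, so `Φ x`,
`Φ y₁`, `Φ y₂` are the components of the diffeomorphism, and the group law of automorphisms is
composition of diffeomorphisms in the reverse order. -/
abbrev Diffeo : Type := FormalSeries ≃ₐ[ℂ] FormalSeries

/-- The push-forward `Φ_* Y = (DΦ · Y) ∘ Φ⁻¹`, characterized by `Φ^* ∘ ℒ_{Φ_* Y} = ℒ_Y ∘ Φ^*`. -/
def pushforward (Φ : Diffeo) (Y : VectorField) : VectorField :=
  Derivation.mk' (Φ.symm.toLinearMap ∘ₗ (Y : FormalSeries →ₗ[ℂ] FormalSeries) ∘ₗ Φ.toLinearMap)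
    (fun f g => by simp)

@[simp] theorem pushforward_apply (Φ : Diffeo) (Y : VectorField) (f : FormalSeries) :
    pushforward Φ Y f = Φ.symm (Y (Φ f)) := rfl

theorem pushforward_one (Y : VectorField) : pushforward 1 Y = Y := by
  ext f; rfl

theorem pushforward_mul (Φ Ψ : Diffeo) (Y : VectorField) :
    pushforward (Φ * Ψ) Y = pushforward Ψ (pushforward Φ Y) := by
  ext f; rfl

theorem pushforward_add (Φ : Diffeo) (Y Z : VectorField) :
    pushforward Φ (Y + Z) = pushforward Φ Y + pushforward Φ Z := by
  ext f; simp

theorem pushforward_smul (Φ : Diffeo) (g : FormalSeries) (Y : VectorField) :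
    pushforward Φ (g • Y) = Φ.symm g • pushforward Φ Y := by
  ext f; simp

/-! ### Formal differential forms of degree one and two -/

/-- Formal 1-forms: the dual of the module of formal vector fields. -/
abbrev OneForm : Type := Module.Dual FormalSeries VectorField

/-- Formal 2-forms: alternating bilinear forms on the module of formal vector fields. -/
abbrev TwoForm : Type := VectorField [⋀^Fin 2]→ₗ[FormalSeries] FormalSeries

/-- A 2-form from a function `f` of two vector fields which is alternating, skew-symmetric and
linear in the first variable. -/
def TwoForm.mk (f : VectorField → VectorField → FormalSeries)
    (hadd : ∀ U U' V, f (U + U') V = f U V + f U' V)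
    (hsmul : ∀ (g : FormalSeries) (U V), f (g • U) V = g * f U V)
    (hskew : ∀ U V, f U V = -f V U) (halt : ∀ U, f U U = 0) : TwoForm where
  toFun w := f (w 0) (w 1)
  map_update_add' := by
    intro inst w i U V
    rw [Subsingleton.elim inst (instDecidableEqFin 2)]
    fin_cases i
    · simp [hadd]
    · simp [hskew (w 0), hadd]; ring
  map_update_smul' := by
    intro inst w i g U
    rw [Subsingleton.elim inst (instDecidableEqFin 2)]
    fin_cases i
    · simp [hsmul]
    · simp [hskew (w 0), hsmul]
  map_eq_zero_of_eq' w i j hw hij := by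
    have h : w 0 = w 1 := by
      fin_cases i <;> fin_cases j <;> first | exact absurd rfl hij | exact hw | exact hw.symm
    rw [h, halt]

theorem TwoForm.ext' {θ η : TwoForm} (h : ∀ U V, θ ![U, V] = η ![U, V]) : θ = η := by
  refine AlternatingMap.ext fun w => ?_
  have hw : w = ![w 0, w 1] := by ext i; fin_cases i <;> rfl
  rw [hw, h]

theorem TwoForm.skew (θ : TwoForm) (U V : VectorField) : θ ![U, V] = -θ ![V, U] := by
  have h := θ.map_swap ![V, U] (i := 0) (j := 1) (by decide)
  rw [← h]
  congr 1
  ext i; fin_cases i <;> rfl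

theorem TwoForm.self (θ : TwoForm) (U : VectorField) : θ ![U, U] = 0 :=
  θ.map_eq_zero_of_eq ![U, U] (i := 0) (j := 1) rfl (by decide)

theorem TwoForm.add_left (θ : TwoForm) (U U' V : VectorField) :
    θ ![U + U', V] = θ ![U, V] + θ ![U', V] :=
  θ.map_vecCons_add ![V] U U'

theorem TwoForm.smul_left (θ : TwoForm) (g : FormalSeries) (U V : VectorField) :
    θ ![g • U, V] = g * θ ![U, V] :=
  θ.map_vecCons_smul ![V] g U

theorem TwoForm.add_right (θ : TwoForm) (U V V' : VectorField) :
    θ ![U, V + V'] = θ ![U, V] + θ ![U, V'] := by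
  rw [θ.skew, θ.add_left, θ.skew V, θ.skew V']; ring

theorem TwoForm.smul_right (θ : TwoForm) (g : FormalSeries) (U V : VectorField) :
    θ ![U, g • V] = g * θ ![U, V] := by
  rw [θ.skew, θ.smul_left, θ.skew V]; ring

/-- The exterior derivative of a function, `(df)(U) = U f`. -/
def d (f : FormalSeries) : OneForm where
  toFun U := U f
  map_add' _ _ := rfl
  map_smul' _ _ := rfl

/-- The exterior product of two 1-forms, `(α ∧ β)(U, V) = α(U) β(V) - α(V) β(U)`. -/
def wedge (α β : OneForm) : TwoForm :=
  TwoForm.mk (fun U V => α U * β V - α V * β U)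
    (fun U U' V => by simp only [map_add]; ring)
    (fun g U V => by simp only [map_smul, smul_eq_mul]; ring)
    (fun U V => by ring) (fun U => by ring)

theorem bracket_add (Y U V : VectorField) : ⁅Y, U + V⁆ = ⁅Y, U⁆ + ⁅Y, V⁆ :=
  Derivation.ext fun f => by
    simp only [Derivation.commutator_apply, Derivation.add_apply, map_add]; ring

theorem bracket_smul (Y U : VectorField) (g : FormalSeries) :
    ⁅Y, g • U⁆ = Y g • U + g • ⁅Y, U⁆ :=
  Derivation.ext fun f => by
    simp only [Derivation.commutator_apply, Derivation.add_apply, Derivation.smul_apply,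
      Derivation.leibniz, smul_eq_mul]; ring

/-- The Lie derivative of a 1-form, `(ℒ_Y α)(U) = Y(α(U)) - α([Y, U])`. -/
def lieOne (Y : VectorField) (α : OneForm) : OneForm where
  toFun U := Y (α U) - α ⁅Y, U⁆
  map_add' U V := by simp only [map_add, bracket_add]; ring
  map_smul' g U := by
    simp only [bracket_smul, map_add, map_smul, smul_eq_mul, Derivation.leibniz, RingHom.id_apply]; ring

/-- The Lie derivative of a 2-form,
`(ℒ_Y θ)(U, V) = Y(θ(U, V)) - θ([Y, U], V) - θ(U, [Y, V])`. -/
def lieTwo (Y : VectorField) (θ : TwoForm) : TwoForm :=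
  TwoForm.mk (fun U V => Y (θ ![U, V]) - θ ![⁅Y, U⁆, V] - θ ![U, ⁅Y, V⁆])
    (fun U U' V => by simp only [TwoForm.add_left, map_add, bracket_add]; ring)
    (fun g U V => by
      simp only [bracket_smul, TwoForm.add_left, TwoForm.smul_left, smul_eq_mul,
        Derivation.leibniz]; ring)
    (fun U V => by
      rw [θ.skew U V, θ.skew U ⁅Y, V⁆, θ.skew V ⁅Y, U⁆, map_neg]; ring)
    (fun U => by rw [θ.self, θ.skew U ⁅Y, U⁆, map_zero]; ring)

/-- The pull-back of a 2-form, `(Φ^* θ)(U, V) = θ(Φ_* U, Φ_* V) ∘ Φ`. -/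
def pullback (Φ : Diffeo) (θ : TwoForm) : TwoForm :=
  TwoForm.mk (fun U V => Φ (θ ![pushforward Φ U, pushforward Φ V]))
    (fun U U' V => by simp only [pushforward_add, TwoForm.add_left, map_add])
    (fun g U V => by
      simp only [pushforward_smul, TwoForm.smul_left, map_mul, AlgEquiv.apply_symm_apply])
    (fun U V => by rw [θ.skew, map_neg])
    (fun U => by rw [θ.self, map_zero])

@[simp] theorem wedge_apply (α β : OneForm) (U V : VectorField) :
    wedge α β ![U, V] = α U * β V - α V * β U := rfl

@[simp] theorem pullback_apply (Φ : Diffeo) (θ : TwoForm) (U V : VectorField) :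
    pullback Φ θ ![U, V] = Φ (θ ![pushforward Φ U, pushforward Φ V]) := rfl

/-- The degree one part of the ideal `⟨dx⟩`. -/
def InIdealDxOne (α : OneForm) : Prop := ∃ f : FormalSeries, α = f • d x

/-- The degree two part of the ideal `⟨dx⟩`. -/
def InIdealDxTwo (θ : TwoForm) : Prop := ∃ η : OneForm, θ = wedge (d x) η

/-- `dy₁ ∧ dy₂`, that is `xω` for the rational form `ω = (dy₁ ∧ dy₂) / x`. -/
def xω : TwoForm := wedge (d y₁) (d y₂)

/-! ### Transversally Hamiltonian vector fields, transversally symplectic diffeomorphisms -/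

/-- `Y` is singular, `ℒ_Y(dx) ∈ ⟨dx⟩` and `x ℒ_Y(ω) ∈ ⟨dx⟩`. For `Y x = x g` one has
`ℒ_Y(θ / x) = -(Y x / x²) θ + (1 / x) ℒ_Y(θ)`, so that `x ℒ_Y(ω) = ℒ_Y(xω) - g xω`. -/
def IsTransvHamiltonian (Y : VectorField) : Prop :=
  IsSingular Y ∧ InIdealDxOne (lieOne Y (d x)) ∧
    ∃ g : FormalSeries, Y x = x * g ∧ InIdealDxTwo (lieTwo Y xω - g • xω)

/-- `Φ^*(x) = x` and `x Φ^*(ω) ∈ xω + ⟨dx⟩`. As `Φ^*(x) = x`, one has `x Φ^*(ω) = Φ^*(xω)`. -/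
def IsTransvSymplectic (Φ : Diffeo) : Prop :=
  Φ x = x ∧ InIdealDxTwo (pullback Φ xω - xω)

theorem isTransvSymplectic_one : IsTransvSymplectic 1 :=
  ⟨rfl, 0, TwoForm.ext' fun U V => by simp [pushforward_one]⟩

theorem pullback_wedge_dx (Φ : Diffeo) (hΦ : Φ x = x) (η : OneForm) :
    InIdealDxTwo (pullback Φ (wedge (d x) η)) := by
  refine ⟨⟨⟨fun U => Φ (η (pushforward Φ U)), ?_⟩, ?_⟩, TwoForm.ext' fun U V => ?_⟩
  · intro U V; simp only [pushforward_add, map_add]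
  · intro g U
    simp only [pushforward_smul, map_smul, smul_eq_mul, map_mul, AlgEquiv.apply_symm_apply,
      RingHom.id_apply]
  · simp [d, hΦ]

theorem IsTransvSymplectic.mul {Φ Ψ : Diffeo} (hΦ : IsTransvSymplectic Φ)
    (hΨ : IsTransvSymplectic Ψ) : IsTransvSymplectic (Φ * Ψ) := by
  obtain ⟨hΦx, η, hη⟩ := hΦ
  obtain ⟨hΨx, ζ, hζ⟩ := hΨ
  obtain ⟨ξ, hξ⟩ := pullback_wedge_dx Φ hΦx ζ
  refine ⟨by rw [AlgEquiv.mul_apply, hΨx, hΦx], η + ξ, TwoForm.ext' fun U V => ?_⟩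
  have h1 := congrArg (fun θ : TwoForm => θ ![U, V]) hη
  have h2 := congrArg (fun θ : TwoForm => θ ![U, V]) hξ
  have h3 := congrArg (fun θ : TwoForm => Φ (θ ![pushforward Φ U, pushforward Φ V])) hζ
  simp only [AlternatingMap.sub_apply, pullback_apply, wedge_apply, pushforward_mul,
    AlgEquiv.mul_apply, map_sub, LinearMap.add_apply] at h1 h2 h3 ⊢
  linear_combination h1 + h2 + h3

theorem IsTransvSymplectic.inv {Φ : Diffeo} (hΦ : IsTransvSymplectic Φ) :
    IsTransvSymplectic Φ⁻¹ := by
  obtain ⟨hΦx, η, hη⟩ := hΦ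
  have hx : Φ⁻¹ x = x := by
    change Φ.symm x = x
    rw [AlgEquiv.symm_apply_eq, hΦx]
  obtain ⟨ξ, hξ⟩ := pullback_wedge_dx Φ⁻¹ hx η
  refine ⟨hx, -ξ, TwoForm.ext' fun U V => ?_⟩
  have h2 := congrArg (fun θ : TwoForm => θ ![U, V]) hξ
  have h3 := congrArg (fun θ : TwoForm =>
    Φ⁻¹ (θ ![pushforward Φ⁻¹ U, pushforward Φ⁻¹ V])) hη
  simp only [AlternatingMap.sub_apply, pullback_apply, wedge_apply, ← pushforward_mul,
    ← AlgEquiv.mul_apply, map_sub, inv_mul_cancel, pushforward_one, AlgEquiv.one_apply,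
    LinearMap.neg_apply] at h2 h3 ⊢
  linear_combination -h2 - h3

/-- The group of transversally symplectic formal diffeomorphisms. -/
def sympDiff : Subgroup Diffeo where
  carrier := {Φ | IsTransvSymplectic Φ}
  mul_mem' := IsTransvSymplectic.mul
  one_mem' := isTransvSymplectic_one
  inv_mem' := IsTransvSymplectic.inv

/-- `Y` and `Z` are conjugate under the group of transversally symplectic diffeomorphisms. -/
def IsSympConj (Y Z : VectorField) : Prop := ∃ Φ ∈ sympDiff, pushforward Φ Y = Z

theorem isSympConj_equivalence : Equivalence IsSympConj where
  refl Y := ⟨1, sympDiff.one_mem, pushforward_one Y⟩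
  symm := by
    rintro Y _ ⟨Φ, hΦ, rfl⟩
    exact ⟨Φ⁻¹, sympDiff.inv_mem hΦ, by
      rw [← pushforward_mul, mul_inv_cancel, pushforward_one]⟩
  trans := by
    rintro Y _ _ ⟨Φ, hΦ, rfl⟩ ⟨Ψ, hΨ, rfl⟩
    exact ⟨Φ * Ψ, sympDiff.mul_mem hΦ hΨ, pushforward_mul Φ Ψ Y⟩

/-! ### Transversally Hamiltonian doubly-resonant saddle-nodes and their classes -/

/-- `Y = x² ∂/∂x + (-λ y₁ + F₁) ∂/∂y₁ + (λ y₂ + F₂) ∂/∂y₂` for some `λ ≠ 0` and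
`F₁, F₂ ∈ 𝔪²`. -/
def IsPrepared (Y : VectorField) : Prop :=
  ∃ l : ℂ, l ≠ 0 ∧ ∃ F₁ ∈ 𝔪 ^ 2, ∃ F₂ ∈ 𝔪 ^ 2,
    Y = ofComponents (x ^ 2) (-(l • y₁) + F₁) (l • y₂ + F₂)

/-- The set of transversally Hamiltonian doubly-resonant saddle-nodes. -/
def saddleNodes : Set VectorField :=
  {Y | IsTransvHamiltonian Y ∧ ∃ Z, IsSympConj Y Z ∧ IsPrepared Z}

/-- Transversally symplectic conjugacy, on transversally Hamiltonian doubly-resonant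
saddle-nodes. -/
def conjSetoid : Setoid saddleNodes where
  r Y Z := IsSympConj Y.1 Z.1
  iseqv := isSympConj_equivalence.comap Subtype.val

/-- The set of transversally symplectic conjugacy classes of transversally Hamiltonian
doubly-resonant saddle-nodes. -/
abbrev ConjClass : Type := Quotient conjSetoid

/-! ### Normal forms -/

/-- The set `{(a₁, a₂) ∈ ℂ² | a₁ + a₂ = 1}`. -/
abbrev ResidueOne : Type := {a : ℂ × ℂ // a.1 + a.2 = 1}

/-- The set `vℂ⟦v⟧` of formal power series with null constant term. -/
abbrev VSeries : Type := {c : PowerSeries ℂ // PowerSeries.constantCoeff c = 0}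

/-- The parameter space `ℂ^* × {a₁ + a₂ = 1} × vℂ⟦v⟧`, with elements `(λ, (a₁, a₂), c)`. -/
abbrev Param : Type := ℂˣ × ResidueOne × VSeries

/-- The formal power series `c(y₁ y₂)`. -/
def atV (c : VSeries) : FormalSeries := PowerSeries.subst (y₁ * y₂) c.1

/-- The vector field
`x² ∂/∂x + (-λ + a₁ x - c(y₁ y₂)) y₁ ∂/∂y₁ + (λ + a₂ x + c(y₁ y₂)) y₂ ∂/∂y₂`. -/
def normalForm (p : Param) : VectorField :=
  ofComponents (x ^ 2)
    ((-MvPowerSeries.C (p.1 : ℂ) + MvPowerSeries.C p.2.1.1.1 * x - atV p.2.2) * y₁)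
    ((MvPowerSeries.C (p.1 : ℂ) + MvPowerSeries.C p.2.1.1.2 * x + atV p.2.2) * y₂)

/-- The involution `(λ, (a₁, a₂), c(v)) ↦ (-λ, (a₂, a₁), -c(-v))` of the parameter space. -/
def flip (p : Param) : Param :=
  (-p.1, ⟨(p.2.1.1.2, p.2.1.1.1), by rw [add_comm]; exact p.2.1.2⟩,
    ⟨-PowerSeries.rescale (-1) p.2.2.1, by
      rw [map_neg, ← PowerSeries.coeff_zero_eq_constantCoeff_apply, PowerSeries.coeff_rescale,
        PowerSeries.coeff_zero_eq_constantCoeff_apply, p.2.2.2, mul_zero, neg_zero]⟩)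

end

end SaddleNode

namespace SaddleNode

open MvPowerSeries (X coeff constantCoeff pderiv)

noncomputable section

/-! ### The filtration by powers of the maximal ideal -/

/-! Once `Φ x = x` and `Y x = x ^ 2`, the two geometric conditions are scalar equations along the
fibres of `x`: the Jacobian `jac (Φ y₁) (Φ y₂)` is 1, and the divergence `transvDiv Y` is `x`.
Conjugacy of `Y` to `Z` reads `Y (Φ f) = Φ (Z f)`. Everything is then graded by the Euler field E =
-y₁∂₁ + y₂∂₂, which multiplies a monomial by its weight m₂ - m₁; the leading part of a prepared
field is λE. Write v = y₁y₂; series of weight zero are series in x and v.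

Existence. A contraction argument (`PreparedWith.exists_resonant`) conjugates a prepared field to
one commuting with E. The conjugating map need not be symplectic, but its Jacobian is an
eigenfunction of the resonant field. Such eigenfunctions are homogeneous for E
(`ResonantWith.euler_eq_smul`), so the Jacobian has weight zero and a map commuting with E corrects
it. The divergence condition now forces Z = x²∂ₓ + A y₁∂₁ + (x - A) y₂∂₂ with A of weight zero. As Z
v = x v, a rescaling (y₁g, y₂/g) with g of weight zero changes A by x(x∂ₓ + v∂ᵥ)g / g. This removes
any element of x𝔪 of weight zero and leaves the constant term, the coefficient of x and the part in
v alone: these are λ, a₁ and c.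

Uniqueness. Linear parts determine λ up to sign, and the quarter turn (y₂, -y₁) realizes the sign
change. If λ is the same, Φ v is an eigenfunction of `normalForm p`, hence has weight zero, hence is
a multiple of v, and the Jacobian makes it v itself. So Φ y₁ = y₁g, and g satisfies the rescaling
equation above; reading it modulo x gives equality of the c's, then dividing by x and evaluating at
0 gives equality of the a's. The moduli space follows by choosing one of λ, -λ in a half-plane. -/

theorem mem_maximal_iff {f : FormalSeries} : f ∈ 𝔪 ↔ constantCoeff f = 0 := Iff.rfl

theorem X_mem_maximal (i : Fin 3) : (X i : FormalSeries) ∈ 𝔪 := by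
  simp [mem_maximal_iff]

theorem mul_mem_pow {f g : FormalSeries} {a b n : ℕ} (hf : f ∈ 𝔪 ^ a) (hg : g ∈ 𝔪 ^ b)
    (h : n ≤ a + b) : f * g ∈ 𝔪 ^ n :=
  Ideal.pow_le_pow_right h (pow_add 𝔪 a b ▸ Ideal.mul_mem_mul hf hg)

theorem mem_pow_of_le {f : FormalSeries} {a n : ℕ} (hf : f ∈ 𝔪 ^ a) (h : n ≤ a) : f ∈ 𝔪 ^ n :=
  Ideal.pow_le_pow_right h hf

theorem coeff_X_mul (i : Fin 3) (m : Fin 3 →₀ ℕ) (f : FormalSeries) :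
    coeff m (X i * f) = if m i = 0 then 0 else coeff (m - Finsupp.single i 1) f := by
  split_ifs with h
  · exact MvPowerSeries.X_dvd_iff.1 (dvd_mul_right _ _) m h
  · have hm : m = Finsupp.single i 1 + (m - Finsupp.single i 1) := by
      rw [add_tsub_cancel_of_le]
      simpa using Nat.one_le_iff_ne_zero.2 h
    conv_lhs => rw [hm]
    rw [MvPowerSeries.X, MvPowerSeries.coeff_add_monomial_mul, one_mul]

theorem coeff_eq_zero_of_mem_pow {n : ℕ} : ∀ {f : FormalSeries}, f ∈ 𝔪 ^ n →
    ∀ m : Fin 3 →₀ ℕ, m.degree < n → coeff m f = 0 := by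
  induction n with
  | zero => intro f _ m hm; simp at hm
  | succ n ih =>
    intro f hf m hm
    rw [pow_succ'] at hf
    induction hf using Submodule.mul_induction_on' with
    | mem_mul_mem a ha b hb =>
      rw [MvPowerSeries.coeff_mul]
      refine Finset.sum_eq_zero fun p hp => ?_
      rw [Finset.HasAntidiagonal.mem_antidiagonal] at hp
      by_cases h0 : p.1 = 0
      · rw [h0, MvPowerSeries.coeff_zero_eq_constantCoeff_apply, mem_maximal_iff.1 ha, zero_mul]
      · have h1 : p.1.degree ≠ 0 := by simpa [Finsupp.degree_eq_zero_iff] using h0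
        have h2 : p.1.degree + p.2.degree = m.degree := by rw [← hp, map_add]
        rw [ih hb p.2 (by omega), mul_zero]
    | add a _ b _ ha hb => rw [map_add, ha, hb, add_zero]

/-- The power series with prescribed coefficients. -/
def ofCoeff (c : (Fin 3 →₀ ℕ) → ℂ) : FormalSeries := c

@[simp] theorem coeff_ofCoeff (c : (Fin 3 →₀ ℕ) → ℂ) (m : Fin 3 →₀ ℕ) :
    coeff m (ofCoeff c) = c m := rfl

/-- Each monomial is charged to the first variable that divides it, so that no coefficient is
counted twice. -/
theorem exists_eq_sum_X_mul {n : ℕ} {f : FormalSeries}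
    (hf : ∀ m : Fin 3 →₀ ℕ, m.degree < n + 1 → coeff m f = 0) :
    ∃ g : Fin 3 → FormalSeries, f = X 0 * g 0 + X 1 * g 1 + X 2 * g 2 ∧
      ∀ i (m : Fin 3 →₀ ℕ), m.degree < n → coeff m (g i) = 0 := by
  refine ⟨![ofCoeff fun m => coeff (m + Finsupp.single 0 1) f,
    ofCoeff fun m => if m 0 = 0 then coeff (m + Finsupp.single 1 1) f else 0,
    ofCoeff fun m => if m 0 = 0 ∧ m 1 = 0 then coeff (m + Finsupp.single 2 1) f else 0], ?_, ?_⟩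
  · ext m
    have key : ∀ i : Fin 3, m i ≠ 0 → m - Finsupp.single i 1 + Finsupp.single i 1 = m := by
      intro i h
      rw [tsub_add_cancel_of_le]
      simpa using Nat.one_le_iff_ne_zero.2 h
    simp only [map_add, coeff_X_mul, Matrix.cons_val_zero, Matrix.cons_val_one, Matrix.cons_val,
      coeff_ofCoeff]
    by_cases h0 : m 0 = 0
    · by_cases h1 : m 1 = 0
      · by_cases h2 : m 2 = 0
        · have : m = 0 := by ext i; fin_cases i <;> simp [h0, h1, h2]
          subst this
          have := hf 0 (by simp)
          simpa using this
        · simp [h0, h1, h2, key]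
      · simp [h0, h1, key]
    · simp [h0, key]
  · intro i m hm
    have key : ∀ i : Fin 3, coeff (m + Finsupp.single i 1) f = 0 := fun i =>
      hf _ (by simp [map_add]; omega)
    fin_cases i
    · exact key 0
    · change (if m 0 = 0 then coeff (m + Finsupp.single 1 1) f else 0) = 0
      simp [key]
    · change (if m 0 = 0 ∧ m 1 = 0 then coeff (m + Finsupp.single 2 1) f else 0) = 0
      simp [key]

theorem mem_pow_iff {n : ℕ} {f : FormalSeries} :
    f ∈ 𝔪 ^ n ↔ ∀ m : Fin 3 →₀ ℕ, m.degree < n → coeff m f = 0 := by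
  refine ⟨coeff_eq_zero_of_mem_pow, ?_⟩
  induction n generalizing f with
  | zero => intro _; simp
  | succ n ih =>
    intro hf
    obtain ⟨g, rfl, hg⟩ := exists_eq_sum_X_mul hf
    rw [pow_succ']
    exact add_mem (add_mem (Ideal.mul_mem_mul (X_mem_maximal 0) (ih (hg 0)))
      (Ideal.mul_mem_mul (X_mem_maximal 1) (ih (hg 1))))
      (Ideal.mul_mem_mul (X_mem_maximal 2) (ih (hg 2)))

theorem exists_eq_sum_X_mul_of_mem {n : ℕ} {f : FormalSeries} (hf : f ∈ 𝔪 ^ (n + 1)) :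
    ∃ g : Fin 3 → FormalSeries, f = X 0 * g 0 + X 1 * g 1 + X 2 * g 2 ∧ ∀ i, g i ∈ 𝔪 ^ n := by
  obtain ⟨g, hg, h⟩ := exists_eq_sum_X_mul (mem_pow_iff.1 hf)
  exact ⟨g, hg, fun i => mem_pow_iff.2 (h i)⟩

theorem exists_eq_const_add (f : FormalSeries) :
    ∃ g : Fin 3 → FormalSeries,
      f = algebraMap ℂ FormalSeries (constantCoeff f) + (X 0 * g 0 + X 1 * g 1 + X 2 * g 2) := by
  have h : f - algebraMap ℂ FormalSeries (constantCoeff f) ∈ 𝔪 ^ (0 + 1) := by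
    rw [zero_add, pow_one, mem_maximal_iff, map_sub, MvPowerSeries.algebraMap_apply]
    simp
  obtain ⟨g, hg, -⟩ := exists_eq_sum_X_mul_of_mem h
  exact ⟨g, by rw [← hg]; ring⟩

theorem eq_zero_of_forall_mem_pow {f : FormalSeries} (h : ∀ n, f ∈ 𝔪 ^ n) : f = 0 := by
  ext m
  exact mem_pow_iff.1 (h (m.degree + 1)) m (Nat.lt_succ_self _)

theorem isUnit_iff_constantCoeff_ne_zero {f : FormalSeries} : IsUnit f ↔ constantCoeff f ≠ 0 := by
  rw [MvPowerSeries.isUnit_iff_constantCoeff, isUnit_iff_ne_zero]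

/-- A self-map of a finite power of `ℂ⟦x, y₁, y₂⟧` that contracts the `𝔪`-adic distance has a
fixed point. -/
theorem exists_fixedPoint {ι : Type*} (T : (ι → FormalSeries) → ι → FormalSeries)
    (hT : ∀ n f g, (∀ i, f i - g i ∈ 𝔪 ^ n) → ∀ i, T f i - T g i ∈ 𝔪 ^ (n + 1)) :
    ∃ f, T f = f := by
  have step : ∀ n i, T^[n + 1] 0 i - T^[n] 0 i ∈ 𝔪 ^ n := by
    intro n
    induction n with
    | zero => intro i; simp
    | succ n ih =>
      intro i
      rw [Function.iterate_succ_apply' T (n + 1), Function.iterate_succ_apply' T n]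
      rw [Function.iterate_succ_apply' T n] at ih
      exact hT n _ _ ih i
  have far : ∀ k n i, T^[n + k] 0 i - T^[n] 0 i ∈ 𝔪 ^ n := by
    intro k
    induction k with
    | zero => intro n i; simp
    | succ k ih =>
      intro n i
      have h := add_mem (mem_pow_of_le (step (n + k) i) (Nat.le_add_right n k)) (ih n i)
      simpa [add_assoc] using h
  -- The coefficient at `m` is stationary from iterate `m.degree + 1` on, so the limit is read off
  -- there.
  let F : ι → FormalSeries := fun i m => coeff m (T^[m.degree + 1] 0 i)
  have hF : ∀ n i, F i - T^[n] 0 i ∈ 𝔪 ^ n := by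
    intro n i
    rw [mem_pow_iff]
    intro m hm
    obtain ⟨k, rfl⟩ := Nat.exists_eq_add_of_le hm
    have h := mem_pow_iff.1 (far k (m.degree + 1) i) m (Nat.lt_succ_self _)
    rw [map_sub, sub_eq_zero] at h ⊢
    rw [show m.degree.succ = m.degree + 1 from rfl, h]
    rfl
  refine ⟨F, funext fun i => ?_⟩
  rw [← sub_eq_zero]
  refine eq_zero_of_forall_mem_pow fun n => ?_
  have h1 := hT n _ _ (hF n) i
  have h2 := hF (n + 1) i
  rw [Function.iterate_succ_apply'] at h2
  have := sub_mem (mem_pow_of_le h1 n.le_succ) (mem_pow_of_le h2 n.le_succ)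
  simpa using this

/-! ### Derivations and algebra homomorphisms are determined by their values on coordinates -/

/-- Continuity of derivations is automatic: in f = f(0) + ∑ Xᵢgᵢ the difference of the two
derivations is ∑ Xᵢ(D - D')gᵢ, which gains one order at each step. `algHom_ext` and `diffeo_subst`
rest on the same induction. -/
theorem derivation_ext {D D' : VectorField} (h : ∀ i, D (X i) = D' (X i)) : D = D' := by
  suffices H : ∀ n f, D f - D' f ∈ 𝔪 ^ n from
    Derivation.ext fun f => sub_eq_zero.1 (eq_zero_of_forall_mem_pow fun n => H n f)
  intro n
  induction n with
  | zero => intro f; simp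
  | succ n ih =>
    intro f
    obtain ⟨g, hg⟩ := exists_eq_const_add f
    have e : D f - D' f = X 0 * (D (g 0) - D' (g 0)) + X 1 * (D (g 1) - D' (g 1)) +
        X 2 * (D (g 2) - D' (g 2)) := by
      rw [hg]
      simp only [map_add, Derivation.map_algebraMap, Derivation.leibniz, smul_eq_mul, h]
      ring
    rw [e, pow_succ']
    exact add_mem (add_mem (Ideal.mul_mem_mul (X_mem_maximal 0) (ih _))
      (Ideal.mul_mem_mul (X_mem_maximal 1) (ih _))) (Ideal.mul_mem_mul (X_mem_maximal 2) (ih _))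

theorem derivation_ext' {D D' : VectorField} (h0 : D x = D' x) (h1 : D y₁ = D' y₁)
    (h2 : D y₂ = D' y₂) : D = D' :=
  derivation_ext fun i => by fin_cases i <;> assumption

theorem algHom_ext {Φ Ψ : FormalSeries →ₐ[ℂ] FormalSeries} (hΦ : ∀ i, Φ (X i) ∈ 𝔪)
    (h : ∀ i, Φ (X i) = Ψ (X i)) : Φ = Ψ := by
  suffices H : ∀ n f, Φ f - Ψ f ∈ 𝔪 ^ n from
    AlgHom.ext fun f => sub_eq_zero.1 (eq_zero_of_forall_mem_pow fun n => H n f)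
  intro n
  induction n with
  | zero => intro f; simp
  | succ n ih =>
    intro f
    obtain ⟨g, hg⟩ := exists_eq_const_add f
    have e : Φ f - Ψ f = Φ (X 0) * (Φ (g 0) - Ψ (g 0)) + Φ (X 1) * (Φ (g 1) - Ψ (g 1)) +
        Φ (X 2) * (Φ (g 2) - Ψ (g 2)) := by
      rw [hg]
      simp only [map_add, AlgHom.commutes, map_mul, h]
      ring
    rw [e, pow_succ']
    exact add_mem (add_mem (Ideal.mul_mem_mul (hΦ 0) (ih _))
      (Ideal.mul_mem_mul (hΦ 1) (ih _))) (Ideal.mul_mem_mul (hΦ 2) (ih _))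

@[simp] theorem pderiv_zero_x : pderiv ℂ 0 x = 1 := MvPowerSeries.pderiv_X_self
@[simp] theorem pderiv_zero_y₁ : pderiv ℂ 0 y₁ = 0 := MvPowerSeries.pderiv_X_of_ne (by decide)
@[simp] theorem pderiv_zero_y₂ : pderiv ℂ 0 y₂ = 0 := MvPowerSeries.pderiv_X_of_ne (by decide)
@[simp] theorem pderiv_one_x : pderiv ℂ 1 x = 0 := MvPowerSeries.pderiv_X_of_ne (by decide)
@[simp] theorem pderiv_one_y₁ : pderiv ℂ 1 y₁ = 1 := MvPowerSeries.pderiv_X_self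
@[simp] theorem pderiv_one_y₂ : pderiv ℂ 1 y₂ = 0 := MvPowerSeries.pderiv_X_of_ne (by decide)
@[simp] theorem pderiv_two_x : pderiv ℂ 2 x = 0 := MvPowerSeries.pderiv_X_of_ne (by decide)
@[simp] theorem pderiv_two_y₁ : pderiv ℂ 2 y₁ = 0 := MvPowerSeries.pderiv_X_of_ne (by decide)
@[simp] theorem pderiv_two_y₂ : pderiv ℂ 2 y₂ = 1 := MvPowerSeries.pderiv_X_self

theorem ofComponents_apply (b b₁ b₂ f : FormalSeries) :
    ofComponents b b₁ b₂ f = b * pderiv ℂ 0 f + b₁ * pderiv ℂ 1 f + b₂ * pderiv ℂ 2 f := rfl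

@[simp] theorem ofComponents_x (b b₁ b₂ : FormalSeries) : ofComponents b b₁ b₂ x = b := by
  simp [ofComponents_apply]

@[simp] theorem ofComponents_y₁ (b b₁ b₂ : FormalSeries) : ofComponents b b₁ b₂ y₁ = b₁ := by
  simp [ofComponents_apply]

@[simp] theorem ofComponents_y₂ (b b₁ b₂ : FormalSeries) : ofComponents b b₁ b₂ y₂ = b₂ := by
  simp [ofComponents_apply]

theorem eq_ofComponents (D : VectorField) : D = ofComponents (D x) (D y₁) (D y₂) :=
  derivation_ext' (by simp) (by simp) (by simp)

theorem vectorField_apply (D : VectorField) (f : FormalSeries) :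
    D f = D x * pderiv ℂ 0 f + D y₁ * pderiv ℂ 1 f + D y₂ * pderiv ℂ 2 f := by
  conv_lhs => rw [eq_ofComponents D, ofComponents_apply]

theorem pderiv_mem_pow (i : Fin 3) {n : ℕ} {f : FormalSeries} (hf : f ∈ 𝔪 ^ (n + 1)) :
    pderiv ℂ i f ∈ 𝔪 ^ n := by
  rw [mem_pow_iff] at hf ⊢
  intro m hm
  rw [MvPowerSeries.coeff_pderiv, hf _ (by simp [map_add]; omega), zero_mul]

theorem pderiv_comm (i j : Fin 3) (f : FormalSeries) :
    pderiv ℂ i (pderiv ℂ j f) = pderiv ℂ j (pderiv ℂ i f) := by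
  have h : ⁅pderiv ℂ i, pderiv ℂ j⁆ = (0 : VectorField) := by
    refine derivation_ext fun k => ?_
    rw [Derivation.commutator_apply]
    simp only [MvPowerSeries.pderiv_X, Pi.single_apply, apply_ite, map_zero, MvPowerSeries.pderiv_one]
    simp
  have := congrArg (fun D : VectorField => D f) h
  simpa [Derivation.commutator_apply, sub_eq_zero] using this

/-- A vector field whose components have order `k + 1` raises the order by `k`. -/
theorem vectorField_mem_pow {D : VectorField} {k n : ℕ} (h0 : D x ∈ 𝔪 ^ (k + 1))
    (h1 : D y₁ ∈ 𝔪 ^ (k + 1)) (h2 : D y₂ ∈ 𝔪 ^ (k + 1)) {f : FormalSeries} (hf : f ∈ 𝔪 ^ n) :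
    D f ∈ 𝔪 ^ (n + k) := by
  rw [vectorField_apply]
  have hd : ∀ i, pderiv ℂ i f ∈ 𝔪 ^ (n - 1) := by
    intro i
    rcases n with _ | n
    · simp
    · exact pderiv_mem_pow i hf
  exact add_mem (add_mem (mul_mem_pow h0 (hd 0) (by omega)) (mul_mem_pow h1 (hd 1) (by omega)))
    (mul_mem_pow h2 (hd 2) (by omega))

/-! ### Substitutions and diffeomorphisms tangent to the identity -/

/-- The substitution of `u i` for the `i`-th coordinate. -/
def substHom (u : Fin 3 → FormalSeries) (hu : ∀ i, u i ∈ 𝔪) : FormalSeries →ₐ[ℂ] FormalSeries :=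
  MvPowerSeries.substAlgHom (MvPowerSeries.hasSubst_of_constantCoeff_zero hu)

@[simp] theorem substHom_X (u : Fin 3 → FormalSeries) (hu : ∀ i, u i ∈ 𝔪) (i : Fin 3) :
    substHom u hu (X i) = u i :=
  MvPowerSeries.substAlgHom_X _ i

@[simp] theorem substHom_x (u : Fin 3 → FormalSeries) (hu : ∀ i, u i ∈ 𝔪) :
    substHom u hu x = u 0 := substHom_X u hu 0

@[simp] theorem substHom_y₁ (u : Fin 3 → FormalSeries) (hu : ∀ i, u i ∈ 𝔪) :
    substHom u hu y₁ = u 1 := substHom_X u hu 1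

@[simp] theorem substHom_y₂ (u : Fin 3 → FormalSeries) (hu : ∀ i, u i ∈ 𝔪) :
    substHom u hu y₂ = u 2 := substHom_X u hu 2

theorem algHom_mem_pow {Φ : FormalSeries →ₐ[ℂ] FormalSeries} (hΦ : ∀ i, Φ (X i) ∈ 𝔪) {n : ℕ}
    {f : FormalSeries} (hf : f ∈ 𝔪 ^ n) : Φ f ∈ 𝔪 ^ n := by
  induction n generalizing f with
  | zero => simp
  | succ n ih =>
    obtain ⟨g, rfl, hg⟩ := exists_eq_sum_X_mul_of_mem hf
    simp only [map_add, map_mul, pow_succ']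
    exact add_mem (add_mem (Ideal.mul_mem_mul (hΦ 0) (ih (hg 0)))
      (Ideal.mul_mem_mul (hΦ 1) (ih (hg 1)))) (Ideal.mul_mem_mul (hΦ 2) (ih (hg 2)))

/-- Substitutions that agree up to order `k + 1` on the coordinates differ by an operator that
raises the order by `k`. -/
theorem algHom_sub_mem_pow {Φ Ψ : FormalSeries →ₐ[ℂ] FormalSeries} (hΦ : ∀ i, Φ (X i) ∈ 𝔪)
    (hΨ : ∀ i, Ψ (X i) ∈ 𝔪) {k n : ℕ} (h : ∀ i, Φ (X i) - Ψ (X i) ∈ 𝔪 ^ (k + 1))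
    {f : FormalSeries} (hf : f ∈ 𝔪 ^ n) : Φ f - Ψ f ∈ 𝔪 ^ (n + k) := by
  have split : ∀ g : Fin 3 → FormalSeries,
      Φ (X 0 * g 0 + X 1 * g 1 + X 2 * g 2) - Ψ (X 0 * g 0 + X 1 * g 1 + X 2 * g 2) =
      ∑ i, ((Φ (X i) - Ψ (X i)) * Φ (g i) + Ψ (X i) * (Φ (g i) - Ψ (g i))) := by
    intro g
    simp only [map_add, map_mul, Fin.sum_univ_three]
    ring
  have base : ∀ j, j ≤ k + 1 → ∀ f, Φ f - Ψ f ∈ 𝔪 ^ j := by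
    intro j
    induction j with
    | zero => intro _ f; simp
    | succ j ih =>
      intro hj f
      obtain ⟨g, hg⟩ := exists_eq_const_add f
      rw [hg, map_add Φ, map_add Ψ, AlgHom.commutes, AlgHom.commutes, add_sub_add_left_eq_sub, split]
      refine sum_mem fun i _ => add_mem (Ideal.mul_mem_right _ _ (mem_pow_of_le (h i) hj)) ?_
      rw [pow_succ']
      exact Ideal.mul_mem_mul (hΨ i) (ih (by omega) _)
  induction n generalizing f with
  | zero => exact mem_pow_of_le (base (k + 1) le_rfl f) (by omega)
  | succ n ih =>
    obtain ⟨g, rfl, hg⟩ := exists_eq_sum_X_mul_of_mem hf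
    rw [split]
    refine sum_mem fun i _ => add_mem
      (mul_mem_pow (h i) (algHom_mem_pow hΦ (hg i)) (by omega)) ?_
    rw [show n + 1 + k = n + k + 1 by ring, pow_succ']
    exact Ideal.mul_mem_mul (hΨ i) (ih (hg i))

/-- Φ - id raises the order by one. This excludes a kernel, and makes f ↦ g - (Φ f - f) a
contraction whose fixed point is a preimage of g. -/
theorem bijective_of_tangent_identity {Φ : FormalSeries →ₐ[ℂ] FormalSeries}
    (h : ∀ i, Φ (X i) - X i ∈ 𝔪 ^ 2) : Function.Bijective Φ := by
  have hid : ∀ i, AlgHom.id ℂ FormalSeries (X i) ∈ 𝔪 := X_mem_maximal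
  have hΦ : ∀ i, Φ (X i) ∈ 𝔪 := fun i => by
    simpa using add_mem (Ideal.pow_le_self two_ne_zero (h i)) (X_mem_maximal i)
  have raise : ∀ n f, f ∈ 𝔪 ^ n → Φ f - f ∈ 𝔪 ^ (n + 1) := fun n f hf =>
    algHom_sub_mem_pow (Ψ := AlgHom.id ℂ FormalSeries) hΦ hid (k := 1) h hf
  constructor
  · rw [injective_iff_map_eq_zero]
    intro f hf
    refine eq_zero_of_forall_mem_pow fun n => ?_
    induction n with
    | zero => simp
    | succ n ih => simpa [hf] using raise n f ih
  · intro g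
    obtain ⟨f, hf⟩ := exists_fixedPoint (ι := Unit) (fun f i => g - (Φ (f i) - f i)) (by
      intro n f f' hff i
      have := neg_mem (raise n _ (hff i))
      rw [map_sub] at this
      convert this using 1
      ring)
    refine ⟨f (), ?_⟩
    have : g - (Φ (f ()) - f ()) = f () := congrFun hf ()
    linear_combination -this

/-- The diffeomorphism tangent to the identity with components `x`, `u₁`, `u₂`. -/
def tangentDiffeo (u₁ u₂ : FormalSeries) (h₁ : u₁ - y₁ ∈ 𝔪 ^ 2) (h₂ : u₂ - y₂ ∈ 𝔪 ^ 2) : Diffeo :=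
  have hu : ∀ i, ![x, u₁, u₂] i - X i ∈ 𝔪 ^ 2 := fun i => by
    fin_cases i
    · change x - x ∈ 𝔪 ^ 2
      simp
    · exact h₁
    · exact h₂
  have hu' : ∀ i, ![x, u₁, u₂] i ∈ 𝔪 := fun i => by
    simpa using add_mem (Ideal.pow_le_self two_ne_zero (hu i)) (X_mem_maximal i)
  AlgEquiv.ofBijective (substHom ![x, u₁, u₂] hu')
    (bijective_of_tangent_identity fun i => by rw [substHom_X]; exact hu i)

section
variable {u₁ u₂ : FormalSeries} {h₁ : u₁ - y₁ ∈ 𝔪 ^ 2} {h₂ : u₂ - y₂ ∈ 𝔪 ^ 2}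

@[simp] theorem tangentDiffeo_x : tangentDiffeo u₁ u₂ h₁ h₂ x = x := by
  simp [tangentDiffeo]
@[simp] theorem tangentDiffeo_y₁ : tangentDiffeo u₁ u₂ h₁ h₂ y₁ = u₁ := by
  simp [tangentDiffeo]
@[simp] theorem tangentDiffeo_y₂ : tangentDiffeo u₁ u₂ h₁ h₂ y₂ = u₂ := by
  simp [tangentDiffeo]

end

/-- Elements of 𝔪 are the non-units, so any algebra automorphism fixes the origin. -/
theorem diffeo_mem_maximal (Φ : Diffeo) {f : FormalSeries} (hf : f ∈ 𝔪) : Φ f ∈ 𝔪 := by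
  by_contra h
  have := isUnit_iff_constantCoeff_ne_zero.2 h
  rw [MulEquiv.isUnit_map, isUnit_iff_constantCoeff_ne_zero] at this
  exact this hf

theorem diffeo_mem_pow (Φ : Diffeo) {n : ℕ} {f : FormalSeries} (hf : f ∈ 𝔪 ^ n) : Φ f ∈ 𝔪 ^ n :=
  algHom_mem_pow (Φ := Φ.toAlgHom) (fun i => diffeo_mem_maximal Φ (X_mem_maximal i)) hf

theorem constantCoeff_diffeo (Φ : Diffeo) (f : FormalSeries) :
    constantCoeff (Φ f) = constantCoeff f := by
  have h : f - algebraMap ℂ FormalSeries (constantCoeff f) ∈ 𝔪 := by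
    rw [mem_maximal_iff, map_sub, MvPowerSeries.algebraMap_apply]
    simp
  have := mem_maximal_iff.1 (diffeo_mem_maximal Φ h)
  rw [map_sub, AlgEquiv.commutes, map_sub, sub_eq_zero, MvPowerSeries.algebraMap_apply] at this
  simpa using this

/-! ### Conjugacy -/

theorem pushforward_eq_iff {Φ : Diffeo} {Y Z : VectorField} :
    pushforward Φ Y = Z ↔ ∀ f, Y (Φ f) = Φ (Z f) := by
  constructor
  · rintro rfl f
    simp
  · intro h
    ext1 f
    simp [h]

theorem forall_conj_of_coordinates {Φ : Diffeo} {Y Z : VectorField} (h0 : Y (Φ x) = Φ (Z x))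
    (h1 : Y (Φ y₁) = Φ (Z y₁)) (h2 : Y (Φ y₂) = Φ (Z y₂)) (f : FormalSeries) :
    Y (Φ f) = Φ (Z f) := by
  have : pushforward Φ Y = Z := derivation_ext' (by simp [h0]) (by simp [h1]) (by simp [h2])
  exact pushforward_eq_iff.1 this f

/-! ### The transverse Jacobian and the transverse divergence -/

/-- The coefficient of `dy₁ ∧ dy₂` in `df ∧ dg`. -/
def jac (f g : FormalSeries) : FormalSeries :=
  pderiv ℂ 1 f * pderiv ℂ 2 g - pderiv ℂ 2 f * pderiv ℂ 1 g

/-- The divergence of `Y` with respect to `dy₁ ∧ dy₂`. -/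
def transvDiv (Y : VectorField) : FormalSeries := pderiv ℂ 1 (Y y₁) + pderiv ℂ 2 (Y y₂)

theorem pderiv_diffeo {Φ : Diffeo} (hx : Φ x = x) {j : Fin 3} (hj : j ≠ 0) (f : FormalSeries) :
    pderiv ℂ j (Φ f) =
      Φ (pderiv ℂ 1 f) * pderiv ℂ j (Φ y₁) + Φ (pderiv ℂ 2 f) * pderiv ℂ j (Φ y₂) := by
  have h := congrArg Φ (vectorField_apply (pushforward Φ (pderiv ℂ j)) f)
  have h0 : pderiv ℂ j x = 0 := MvPowerSeries.pderiv_X_of_ne hj.symm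
  simp only [pushforward_apply, map_add, map_mul, AlgEquiv.apply_symm_apply, hx, h0] at h
  linear_combination h

theorem jac_diffeo {Φ : Diffeo} (hx : Φ x = x) (f g : FormalSeries) :
    jac (Φ f) (Φ g) = Φ (jac f g) * jac (Φ y₁) (Φ y₂) := by
  simp only [jac, pderiv_diffeo hx (j := 1) (by decide) f, pderiv_diffeo hx (j := 1) (by decide) g,
    pderiv_diffeo hx (j := 2) (by decide) f, pderiv_diffeo hx (j := 2) (by decide) g, map_sub,
    map_mul]
  ring

/-- This is Leibniz for the Lie derivative of df ∧ dg modulo dx; the hypotheses on `Y x` make the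
Lie derivative preserve ⟨dx⟩, and the divergence is the factor by which it acts on dy₁ ∧ dy₂. -/
theorem vectorField_jac {Y : VectorField} (h1 : pderiv ℂ 1 (Y x) = 0) (h2 : pderiv ℂ 2 (Y x) = 0)
    (f g : FormalSeries) :
    Y (jac f g) = jac (Y f) g + jac f (Y g) - transvDiv Y * jac f g := by
  rw [vectorField_apply Y (jac f g), vectorField_apply Y f, vectorField_apply Y g]
  simp only [jac, transvDiv, map_add, map_sub, Derivation.leibniz, smul_eq_mul, h1, h2,
    pderiv_comm 1 0, pderiv_comm 2 0, pderiv_comm 2 1]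
  ring

/-- With Jacobian 1 this transports the divergence; otherwise it shows that the Jacobian is an
eigenfunction of `Y`. -/
theorem vectorField_jac_of_conj {Φ : Diffeo} {Y Z : VectorField} (hx : Φ x = x)
    (hY : Y x = x ^ 2) (h : ∀ f, Y (Φ f) = Φ (Z f)) :
    Y (jac (Φ y₁) (Φ y₂)) = (Φ (transvDiv Z) - transvDiv Y) * jac (Φ y₁) (Φ y₂) := by
  rw [vectorField_jac (by simp [hY]) (by simp [hY]), h, h, jac_diffeo hx (Z y₁),
    jac_diffeo hx y₁ (Z y₂)]
  simp only [transvDiv, jac, map_add, pderiv_one_y₁, pderiv_one_y₂, pderiv_two_y₁, pderiv_two_y₂,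
    map_mul, map_sub, map_one, map_zero]
  ring

theorem inIdealDxOne_iff {α : OneForm} :
    InIdealDxOne α ↔ α (pderiv ℂ 1) = 0 ∧ α (pderiv ℂ 2) = 0 := by
  constructor
  · rintro ⟨f, rfl⟩
    simp [d]
  · rintro ⟨h1, h2⟩
    refine ⟨α (pderiv ℂ 0), LinearMap.ext fun U => ?_⟩
    rw [eq_ofComponents U, ofComponents]
    simp only [map_add, map_smul, h1, h2]
    simp [d, mul_comm]

theorem inIdealDxTwo_iff {θ : TwoForm} :
    InIdealDxTwo θ ↔ θ ![pderiv ℂ 1, pderiv ℂ 2] = 0 := by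
  constructor
  · rintro ⟨η, rfl⟩
    simp [d]
  · intro h
    -- The cofactor of dx is the contraction of θ with ∂ₓ.
    refine ⟨⟨⟨fun U => θ ![pderiv ℂ 0, U], θ.add_right _⟩, fun g U => θ.smul_right g _ U⟩,
      TwoForm.ext' fun U V => ?_⟩
    rw [wedge_apply]
    change _ = U x * θ ![pderiv ℂ 0, V] - V x * θ ![pderiv ℂ 0, U]
    have h' : θ ![pderiv ℂ 2, pderiv ℂ 1] = 0 := by rw [θ.skew, h, neg_zero]
    have exp : ∀ A B : VectorField, θ ![A, B] = B x * θ ![A, pderiv ℂ 0] +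
        B y₁ * θ ![A, pderiv ℂ 1] + B y₂ * θ ![A, pderiv ℂ 2] := by
      intro A B
      conv_lhs => rw [eq_ofComponents B, ofComponents]
      simp only [TwoForm.add_right, TwoForm.smul_right]
    rw [exp U V, θ.skew U, θ.skew U, θ.skew U, exp _ U, exp _ U, exp _ U, exp _ V]
    rw [θ.self, θ.self, θ.self, h, h', θ.skew (pderiv ℂ 1) (pderiv ℂ 0),
      θ.skew (pderiv ℂ 2) (pderiv ℂ 0)]
    ring

theorem isTransvSymplectic_iff {Φ : Diffeo} :
    IsTransvSymplectic Φ ↔ Φ x = x ∧ jac (Φ y₁) (Φ y₂) = 1 := by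
  rw [IsTransvSymplectic, inIdealDxTwo_iff]
  refine and_congr_right fun hx => ?_
  rw [AlternatingMap.sub_apply, pullback_apply, xω, wedge_apply, wedge_apply, sub_eq_zero]
  simp [d, jac, mul_comm]

theorem isSympConj_iff {Y Z : VectorField} : IsSympConj Y Z ↔
    ∃ Φ : Diffeo, Φ x = x ∧ jac (Φ y₁) (Φ y₂) = 1 ∧ ∀ f, Y (Φ f) = Φ (Z f) := by
  refine exists_congr fun Φ => ?_
  rw [← and_assoc, ← isTransvSymplectic_iff, pushforward_eq_iff]
  rfl

/-- The cofactor of `Y x = x * g` can only be `g = x`, and the Lie derivative of dy₁ ∧ dy₂ evaluated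
on (∂₁, ∂₂) is the divergence. -/
theorem isTransvHamiltonian_iff {Y : VectorField} (hY : Y x = x ^ 2) :
    IsTransvHamiltonian Y ↔ IsSingular Y ∧ transvDiv Y = x := by
  have hlie : lieTwo Y xω ![pderiv ℂ 1, pderiv ℂ 2] = transvDiv Y := by
    change Y (xω ![pderiv ℂ 1, pderiv ℂ 2]) - xω ![⁅Y, pderiv ℂ 1⁆, pderiv ℂ 2] -
      xω ![pderiv ℂ 1, ⁅Y, pderiv ℂ 2⁆] = _
    simp [xω, d, transvDiv, Derivation.commutator_apply]
  have hω : xω ![pderiv ℂ 1, pderiv ℂ 2] = 1 := by simp [xω, d]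
  have hg : ∀ g, Y x = x * g ↔ g = x := by
    intro g
    rw [hY, pow_two]
    have hx : x ≠ 0 := fun h => by simpa [h] using pderiv_zero_x
    rw [mul_right_inj' hx]
    exact eq_comm
  have hone : InIdealDxOne (lieOne Y (d x)) := by
    rw [inIdealDxOne_iff]
    simp [lieOne, d, Derivation.commutator_apply, hY]
  rw [IsTransvHamiltonian]
  simp only [hg, exists_eq_left, hone, true_and, inIdealDxTwo_iff, AlternatingMap.sub_apply, hlie,
    AlternatingMap.smul_apply, hω, smul_eq_mul, mul_one, sub_eq_zero]

/-! ### The Euler field of the resonant grading -/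

theorem coeff_X_mul_pderiv (i : Fin 3) (m : Fin 3 →₀ ℕ) (f : FormalSeries) :
    coeff m (X i * pderiv ℂ i f) = m i * coeff m f := by
  rw [coeff_X_mul]
  split_ifs with h
  · simp [h]
  · have hle : Finsupp.single i 1 ≤ m := by simpa using Nat.one_le_iff_ne_zero.2 h
    rw [MvPowerSeries.coeff_pderiv, tsub_add_cancel_of_le hle, mul_comm]
    congr 1
    have : 1 ≤ m i := Nat.one_le_iff_ne_zero.2 h
    simp [Nat.cast_sub this]

/-- The vector field `-y₁ ∂/∂y₁ + y₂ ∂/∂y₂`. -/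
def euler : VectorField := ofComponents 0 (-y₁) y₂

@[simp] theorem euler_x : euler x = 0 := ofComponents_x _ _ _
@[simp] theorem euler_y₁ : euler y₁ = -y₁ := ofComponents_y₁ _ _ _
@[simp] theorem euler_y₂ : euler y₂ = y₂ := ofComponents_y₂ _ _ _

theorem euler_apply (f : FormalSeries) :
    euler f = y₂ * pderiv ℂ 2 f - y₁ * pderiv ℂ 1 f := by
  rw [euler, ofComponents_apply]; ring

theorem coeff_euler (m : Fin 3 →₀ ℕ) (f : FormalSeries) :
    coeff m (euler f) = ((m 2 : ℂ) - m 1) * coeff m f := by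
  rw [euler_apply, map_sub, y₁, y₂, coeff_X_mul_pderiv, coeff_X_mul_pderiv]; ring

theorem coeff_eq_zero_of_euler_eq_smul {κ : ℂ} {f : FormalSeries} (hf : euler f = κ • f)
    {m : Fin 3 →₀ ℕ} (hm : (m 2 : ℂ) - m 1 ≠ κ) : coeff m f = 0 := by
  have h := congrArg (coeff m) hf
  rw [coeff_euler, MvPowerSeries.coeff_smul, ← sub_eq_zero, ← sub_mul] at h
  exact (mul_eq_zero.1 h).resolve_left (sub_ne_zero.2 hm)

theorem euler_eq_smul_of_coeff {κ : ℂ} {f : FormalSeries}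
    (hf : ∀ m : Fin 3 →₀ ℕ, (m 2 : ℂ) - m 1 ≠ κ → coeff m f = 0) : euler f = κ • f := by
  ext m
  rw [coeff_euler, MvPowerSeries.coeff_smul]
  by_cases h : (m 2 : ℂ) - m 1 = κ
  · rw [h]
  · rw [hf m h]; simp

theorem euler_pderiv_one (f : FormalSeries) :
    euler (pderiv ℂ 1 f) = pderiv ℂ 1 (euler f) + pderiv ℂ 1 f := by
  simp only [euler_apply, map_sub, Derivation.leibniz, smul_eq_mul, pderiv_one_y₁, pderiv_one_y₂,
    pderiv_comm 1 2]
  ring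

theorem euler_pderiv_two (f : FormalSeries) :
    euler (pderiv ℂ 2 f) = pderiv ℂ 2 (euler f) - pderiv ℂ 2 f := by
  simp only [euler_apply, map_sub, Derivation.leibniz, smul_eq_mul, pderiv_two_y₁, pderiv_two_y₂,
    pderiv_comm 1 2]
  ring

/-! ### Prepared and resonant vector fields -/

/-- `Z = x² ∂/∂x + (-λ y₁ + ⋯) ∂/∂y₁ + (λ y₂ + ⋯) ∂/∂y₂`. -/
structure PreparedWith (l : ℂ) (Z : VectorField) : Prop where
  apply_x : Z x = x ^ 2
  apply_y₁ : Z y₁ + l • y₁ ∈ 𝔪 ^ 2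
  apply_y₂ : Z y₂ - l • y₂ ∈ 𝔪 ^ 2

theorem isPrepared_iff {Z : VectorField} : IsPrepared Z ↔ ∃ l, l ≠ 0 ∧ PreparedWith l Z := by
  constructor
  · rintro ⟨l, hl, F₁, hF₁, F₂, hF₂, rfl⟩
    exact ⟨l, hl, by simp, by simpa using hF₁, by simpa using hF₂⟩
  · rintro ⟨l, hl, h⟩
    refine ⟨l, hl, _, h.apply_y₁, _, h.apply_y₂, derivation_ext' ?_ ?_ ?_⟩
    · simp [h.apply_x]
    · simp
    · simp

theorem y₁_mem : y₁ ∈ 𝔪 := X_mem_maximal 1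
theorem y₂_mem : y₂ ∈ 𝔪 := X_mem_maximal 2
theorem x_mem : x ∈ 𝔪 := X_mem_maximal 0

theorem smul_mem_ideal {I : Ideal FormalSeries} (c : ℂ) {f : FormalSeries} (hf : f ∈ I) :
    c • f ∈ I := by
  rw [MvPowerSeries.smul_eq_C_mul]
  exact Ideal.mul_mem_left _ _ hf

theorem PreparedWith.isSingular {l : ℂ} {Z : VectorField} (h : PreparedWith l Z) :
    IsSingular Z := by
  refine ⟨?_, ?_, ?_⟩
  · rw [h.apply_x]
    exact Ideal.pow_le_self two_ne_zero (Ideal.pow_mem_pow x_mem 2)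
  · simpa using sub_mem (Ideal.pow_le_self two_ne_zero h.apply_y₁) (smul_mem_ideal l y₁_mem)
  · simpa using add_mem (Ideal.pow_le_self two_ne_zero h.apply_y₂) (smul_mem_ideal l y₂_mem)

theorem PreparedWith.sub_euler_mem_pow {l : ℂ} {Z : VectorField} (h : PreparedWith l Z) {n : ℕ}
    {f : FormalSeries} (hf : f ∈ 𝔪 ^ n) : Z f - l • euler f ∈ 𝔪 ^ (n + 1) := by
  have := vectorField_mem_pow (D := Z - l • euler) (k := 1) (n := n)
    (by simpa [h.apply_x] using Ideal.pow_mem_pow x_mem 2)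
    (by simpa using h.apply_y₁) (by simpa using h.apply_y₂) hf
  simpa using this

/-- A prepared vector field that commutes with the Euler field. -/
structure ResonantWith (l : ℂ) (Z : VectorField) : Prop extends PreparedWith l Z where
  euler_apply_y₁ : euler (Z y₁) = -Z y₁
  euler_apply_y₂ : euler (Z y₂) = Z y₂

theorem ResonantWith.comm {l : ℂ} {Z : VectorField} (h : ResonantWith l Z) (f : FormalSeries) :
    Z (euler f) = euler (Z f) := by
  have : ⁅Z, euler⁆ = 0 := by
    refine derivation_ext' ?_ ?_ ?_
    · simp [Derivation.commutator_apply, h.apply_x]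
    · simp [Derivation.commutator_apply, h.euler_apply_y₁]
    · simp [Derivation.commutator_apply, h.euler_apply_y₂]
  have := congrArg (fun D : VectorField => D f) this
  simpa [Derivation.commutator_apply, sub_eq_zero] using this

/-- Eigenfunctions of resonant vector fields are homogeneous for the Euler field. -/
theorem ResonantWith.euler_eq_smul {l κ : ℂ} (hl : l ≠ 0) {Z : VectorField}
    (h : ResonantWith l Z) {r f : FormalSeries} (hr : euler r = 0)
    (hr0 : constantCoeff r = κ * l) (hf : Z f = r * f) : euler f = κ • f := by
  -- `g` is again an eigenfunction for `r`, since `Z` commutes with E. If it has order n, comparing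
  -- leading parts gives λ(E - κ)g ∈ 𝔪ⁿ⁺¹.
  set g := euler f - κ • f with hg
  have hZg : Z g = r * g := by
    rw [hg, map_sub, h.comm, hf, Derivation.leibniz, hr, Derivation.map_smul, hf]
    simp only [smul_eq_mul, MvPowerSeries.smul_eq_C_mul]
    ring
  suffices H : ∀ n, g ∈ 𝔪 ^ n from sub_eq_zero.1 (eq_zero_of_forall_mem_pow H)
  intro n
  induction n with
  | zero => simp
  | succ n ih =>
    have h1 := h.sub_euler_mem_pow ih
    have h2 : (r - MvPowerSeries.C (κ * l)) * g ∈ 𝔪 ^ (n + 1) := by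
      rw [pow_succ']
      exact Ideal.mul_mem_mul (by rw [mem_maximal_iff]; simp [hr0]) ih
    have h3 : l • (euler g - κ • g) ∈ 𝔪 ^ (n + 1) := by
      convert sub_mem h2 h1 using 1
      rw [hZg]
      simp only [MvPowerSeries.smul_eq_C_mul, map_mul]
      ring
    rw [mem_pow_iff] at h3 ⊢
    intro m hm
    have h4 := h3 m hm
    rw [MvPowerSeries.coeff_smul, map_sub, coeff_euler, MvPowerSeries.coeff_smul, ← sub_mul] at h4
    have h5 := (mul_eq_zero.1 h4).resolve_left hl
    rcases mul_eq_zero.1 h5 with h6 | h6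
    -- On monomials of weight κ the coefficient vanishes anyway, because `g` lies in the image of E
    -- - κ.
    · rw [hg, map_sub, coeff_euler, MvPowerSeries.coeff_smul, ← sub_mul, h6, zero_mul]
    · exact h6

/-! ### Elimination of the non-resonant terms -/

/-- The solution of `l (E - κ) f = g` without resonant terms, for the Euler field `E` and for the
non-resonant part of `g`. -/
def homologicalInverse (l κ : ℂ) (g : FormalSeries) : FormalSeries :=
  ofCoeff fun m => if m.degree < 2 then 0 else
    if (m 2 : ℂ) - m 1 = κ then 0 else coeff m g / (l * ((m 2 : ℂ) - m 1 - κ))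

/-- The resonant part of a power series, for the eigenvalue `κ` of the Euler field. -/
def resonantPart (κ : ℂ) (g : FormalSeries) : FormalSeries :=
  ofCoeff fun m => if m.degree < 2 then 0 else if (m 2 : ℂ) - m 1 = κ then coeff m g else 0

/-- The cut-off below degree two gives this for arbitrary input, so the map and the field below
exist before their data `G` is known to have order two. -/
theorem homologicalInverse_mem (l κ : ℂ) (g : FormalSeries) : homologicalInverse l κ g ∈ 𝔪 ^ 2 :=
  mem_pow_iff.2 fun m hm => by
    rw [homologicalInverse, coeff_ofCoeff, if_pos hm]

theorem resonantPart_mem (κ : ℂ) (g : FormalSeries) : resonantPart κ g ∈ 𝔪 ^ 2 :=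
  mem_pow_iff.2 fun m hm => by
    rw [resonantPart, coeff_ofCoeff, if_pos hm]

theorem homologicalInverse_sub_mem (l κ : ℂ) {n : ℕ} {f g : FormalSeries} (h : f - g ∈ 𝔪 ^ n) :
    homologicalInverse l κ f - homologicalInverse l κ g ∈ 𝔪 ^ n := by
  rw [mem_pow_iff] at h ⊢
  intro m hm
  have := h m hm
  rw [map_sub, sub_eq_zero] at this
  simp [homologicalInverse, this]

theorem resonantPart_sub_mem (κ : ℂ) {n : ℕ} {f g : FormalSeries} (h : f - g ∈ 𝔪 ^ n) :
    resonantPart κ f - resonantPart κ g ∈ 𝔪 ^ n := by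
  rw [mem_pow_iff] at h ⊢
  intro m hm
  have := h m hm
  rw [map_sub, sub_eq_zero] at this
  simp [resonantPart, this]

theorem euler_resonantPart (κ : ℂ) (g : FormalSeries) :
    euler (resonantPart κ g) = κ • resonantPart κ g :=
  euler_eq_smul_of_coeff fun m hm => by simp [resonantPart, hm]

theorem homological_decomposition {l : ℂ} (hl : l ≠ 0) (κ : ℂ) {g : FormalSeries}
    (hg : g ∈ 𝔪 ^ 2) :
    l • (euler (homologicalInverse l κ g) - κ • homologicalInverse l κ g) + resonantPart κ g
      = g := by
  ext m
  rw [map_add, MvPowerSeries.coeff_smul, map_sub, coeff_euler, MvPowerSeries.coeff_smul, ← sub_mul]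
  simp only [homologicalInverse, resonantPart, coeff_ofCoeff]
  by_cases hm : m.degree < 2
  · simp [hm, mem_pow_iff.1 hg m hm]
  · by_cases hw : (m 2 : ℂ) - m 1 = κ
    · simp [hm, hw]
    · have := sub_ne_zero.2 hw
      simp only [hm, hw, if_false, add_zero]
      field_simp

/-- A single unknown pair G encodes both the map yᵢ + ψᵢ (ψᵢ solves λ(Eψᵢ - κᵢψᵢ) = non-resonant
part of Gᵢ) and the resonant field λE + V (V yᵢ = resonant part of Gᵢ). The conjugacy equation then
becomes Gᵢ = Ψ(Fᵢ) - V(ψᵢ), a fixed-point problem. -/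
theorem PreparedWith.exists_resonant {l : ℂ} (hl : l ≠ 0) {Y : VectorField}
    (hY : PreparedWith l Y) :
    ∃ (Z : VectorField) (Ψ : Diffeo), ResonantWith l Z ∧ Ψ x = x ∧ Ψ y₁ - y₁ ∈ 𝔪 ^ 2 ∧
      Ψ y₂ - y₂ ∈ 𝔪 ^ 2 ∧ ∀ f, Z (Ψ f) = Ψ (Y f) := by
  let κ : Fin 2 → ℂ := ![-1, 1]
  let F : Fin 2 → FormalSeries := ![Y y₁ + l • y₁, Y y₂ - l • y₂]
  have hF : ∀ i, F i ∈ 𝔪 ^ 2 := fun i => by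
    fin_cases i
    · exact hY.apply_y₁
    · exact hY.apply_y₂
  let ψ : (Fin 2 → FormalSeries) → Fin 2 → FormalSeries :=
    fun G i => homologicalInverse l (κ i) (G i)
  have hψ : ∀ G i, ψ G i ∈ 𝔪 ^ 2 := fun G i => homologicalInverse_mem _ _ _
  let Ψ : (Fin 2 → FormalSeries) → Diffeo := fun G =>
    tangentDiffeo (y₁ + ψ G 0) (y₂ + ψ G 1) (by simpa using hψ G 0) (by simpa using hψ G 1)
  let V : (Fin 2 → FormalSeries) → VectorField := fun G =>
    ofComponents (x ^ 2) (resonantPart (κ 0) (G 0)) (resonantPart (κ 1) (G 1))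
  have hx2 : x ^ 2 ∈ 𝔪 ^ 2 := Ideal.pow_mem_pow x_mem 2
  have hV : ∀ G n f, f ∈ 𝔪 ^ n → V G f ∈ 𝔪 ^ (n + 1) := fun G n f hf =>
    vectorField_mem_pow (k := 1) (by simpa [V] using hx2) (by simpa [V] using resonantPart_mem _ _)
      (by simpa [V] using resonantPart_mem _ _) hf
  obtain ⟨G, hG⟩ := exists_fixedPoint (fun G i => Ψ G (F i) - V G (ψ G i)) (by
    intro n G G' h i
    have hΨ : Ψ G (F i) - Ψ G' (F i) ∈ 𝔪 ^ (n + 1) := by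
      -- Since `F i` has order two, substitutions agreeing to order n + 1 give values agreeing to
      -- order n + 2. For n = 0 nothing is known of G - G', and the order of `F i` alone suffices.
      rcases n with _ | n
      · exact mem_pow_of_le (sub_mem (diffeo_mem_pow _ (hF i)) (diffeo_mem_pow _ (hF i)))
          (by omega)
      · rw [show n + 1 + 1 = 2 + n by ring]
        refine algHom_sub_mem_pow (Φ := (Ψ G).toAlgHom) (Ψ := (Ψ G').toAlgHom)
          (fun j => diffeo_mem_maximal _ (X_mem_maximal j))
          (fun j => diffeo_mem_maximal _ (X_mem_maximal j)) (fun j => ?_) (hF i)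
        fin_cases j
        · change Ψ G x - Ψ G' x ∈ _
          simp [Ψ]
        · change Ψ G y₁ - Ψ G' y₁ ∈ _
          simpa [Ψ] using homologicalInverse_sub_mem l (κ 0) (h 0)
        · change Ψ G y₂ - Ψ G' y₂ ∈ _
          simpa [Ψ] using homologicalInverse_sub_mem l (κ 1) (h 1)
    have h1 : V G (ψ G i - ψ G' i) ∈ 𝔪 ^ (n + 1) :=
      hV _ _ _ (homologicalInverse_sub_mem l (κ i) (h i))
    have h2 : V G (ψ G' i) - V G' (ψ G' i) ∈ 𝔪 ^ (n + 1) := by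
      have e : V G (ψ G' i) - V G' (ψ G' i) =
          (resonantPart (κ 0) (G 0) - resonantPart (κ 0) (G' 0)) * pderiv ℂ 1 (ψ G' i) +
          (resonantPart (κ 1) (G 1) - resonantPart (κ 1) (G' 1)) * pderiv ℂ 2 (ψ G' i) := by
        simp only [V, ofComponents_apply]
        ring
      rw [e]
      exact add_mem
        (mul_mem_pow (resonantPart_sub_mem _ (h 0)) (pderiv_mem_pow (n := 1) _ (hψ G' i)) le_rfl)
        (mul_mem_pow (resonantPart_sub_mem _ (h 1)) (pderiv_mem_pow (n := 1) _ (hψ G' i)) le_rfl)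
    convert sub_mem hΨ (add_mem h1 h2) using 1
    rw [map_sub]
    ring)
  have hG' : ∀ i, Ψ G (F i) - V G (ψ G i) = G i := fun i => congrFun hG i
  have hGm : ∀ i, G i ∈ 𝔪 ^ 2 := fun i => by
    rw [← hG' i]
    exact sub_mem (diffeo_mem_pow _ (hF i)) (mem_pow_of_le (hV G 2 _ (hψ G i)) (by omega))
  have hdec : ∀ i, l • (euler (ψ G i) - κ i • ψ G i) + resonantPart (κ i) (G i) =
      Ψ G (F i) - V G (ψ G i) := fun i => by
    rw [hG' i]
    exact homological_decomposition hl (κ i) (hGm i)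
  refine ⟨l • euler + V G, Ψ G, ⟨⟨?_, ?_, ?_⟩, ?_, ?_⟩, ?_, ?_, ?_,
    forall_conj_of_coordinates ?_ ?_ ?_⟩
  · simp [V]
  · simpa [V] using resonantPart_mem _ _
  · simpa [V] using resonantPart_mem _ _
  · have := euler_resonantPart (-1) (G 0)
    simp [V, this, κ]
    ring
  · have := euler_resonantPart 1 (G 1)
    simp [V, this, κ]
  · simp [Ψ]
  · simpa [Ψ] using hψ G 0
  · simpa [Ψ] using hψ G 1
  · simp [Ψ, V, hY.apply_x]
  · have h := hdec 0
    have e : Ψ G (Y y₁) = Ψ G (F 0) - l • Ψ G y₁ := by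
      rw [← map_smul, ← map_sub]
      simp [F]
    rw [e]
    have e1 : Ψ G y₁ = y₁ + ψ G 0 := by simp [Ψ]
    have e2 : V G y₁ = resonantPart (κ 0) (G 0) := by simp [V]
    have e3 : κ 0 = -1 := rfl
    rw [e3] at h e2
    rw [e1, map_add, Derivation.add_apply, Derivation.add_apply, e2, Derivation.smul_apply,
      Derivation.smul_apply, euler_y₁]
    simp only [MvPowerSeries.smul_eq_C_mul, map_neg, map_one] at h ⊢
    linear_combination h
  · have h := hdec 1
    have e : Ψ G (Y y₂) = Ψ G (F 1) + l • Ψ G y₂ := by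
      rw [← map_smul, ← map_add]
      simp [F]
    rw [e]
    have e1 : Ψ G y₂ = y₂ + ψ G 1 := by simp [Ψ]
    have e2 : V G y₂ = resonantPart (κ 1) (G 1) := by simp [V]
    have e3 : κ 1 = 1 := rfl
    rw [e3] at h e2
    rw [e1, map_add, Derivation.add_apply, Derivation.add_apply, e2, Derivation.smul_apply,
      Derivation.smul_apply, euler_y₂]
    simp only [MvPowerSeries.smul_eq_C_mul, map_one] at h ⊢
    linear_combination h

/-! ### Making the normalization symplectic -/

theorem ResonantWith.pushforward {l : ℂ} {Z : VectorField} (h : ResonantWith l Z) {Θ : Diffeo}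
    (hx : Θ x = x) (h1 : euler (Θ y₁) = -Θ y₁) (h2 : euler (Θ y₂) = Θ y₂) :
    ResonantWith l (pushforward Θ Z) := by
  have hE : ∀ f, euler (Θ.symm f) = Θ.symm (euler f) := by
    intro f
    have := forall_conj_of_coordinates (Φ := Θ) (Y := euler) (Z := euler) (by simp [hx])
      (by simp [h1]) (by simp [h2]) (Θ.symm f)
    rw [AlgEquiv.apply_symm_apply] at this
    rw [this, AlgEquiv.symm_apply_apply]
  have hx' : Θ.symm x = x := by rw [AlgEquiv.symm_apply_eq, hx]
  have hm : ∀ f ∈ 𝔪, Θ.symm (Z (Θ f) - l • euler (Θ f)) ∈ 𝔪 ^ 2 := fun f hf =>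
    diffeo_mem_pow _ (h.sub_euler_mem_pow (n := 1) (by simpa using diffeo_mem_maximal Θ hf))
  refine ⟨⟨?_, ?_, ?_⟩, ?_, ?_⟩
  · simp [hx, h.apply_x, hx']
  · simpa [h1] using hm _ y₁_mem
  · simpa [h2] using hm _ y₂_mem
  · rw [pushforward_apply, hE, ← h.comm, h1, map_neg, map_neg]
  · rw [pushforward_apply, hE, ← h.comm, h2]

theorem constantCoeff_eq_of_sub_mem {f g : FormalSeries} (h : f - g ∈ 𝔪) :
    constantCoeff f = constantCoeff g := by
  rwa [mem_maximal_iff, map_sub, sub_eq_zero] at h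

theorem constantCoeff_pderiv_eq {f g : FormalSeries} (i : Fin 3) (h : f - g ∈ 𝔪 ^ 2) :
    constantCoeff (pderiv ℂ i f) = constantCoeff (pderiv ℂ i g) :=
  constantCoeff_eq_of_sub_mem (by simpa using pderiv_mem_pow (n := 1) i h)

@[simp] theorem constantCoeff_x : constantCoeff x = 0 := MvPowerSeries.constantCoeff_X 0
@[simp] theorem constantCoeff_y₁ : constantCoeff y₁ = 0 := MvPowerSeries.constantCoeff_X 1
@[simp] theorem constantCoeff_y₂ : constantCoeff y₂ = 0 := MvPowerSeries.constantCoeff_X 2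

theorem PreparedWith.constantCoeff_transvDiv {l : ℂ} {Z : VectorField} (h : PreparedWith l Z) :
    constantCoeff (transvDiv Z) = 0 := by
  have h1 := constantCoeff_pderiv_eq (f := Z y₁) (g := -(l • y₁)) 1 (by simpa using h.apply_y₁)
  have h2 := constantCoeff_pderiv_eq 2 h.apply_y₂
  rw [transvDiv, map_add, h1, h2]
  simp [MvPowerSeries.smul_eq_C_mul]

theorem ResonantWith.euler_transvDiv {l : ℂ} {Z : VectorField} (h : ResonantWith l Z) :
    euler (transvDiv Z) = 0 := by
  rw [transvDiv, map_add, euler_pderiv_one, euler_pderiv_two, h.euler_apply_y₁, h.euler_apply_y₂,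
    map_neg]
  ring

/-- A series `J` of weight zero is `∂(y₁ g)/∂y₁` for some `g` of weight zero. -/
theorem exists_pderiv_y₁_mul_eq {J : FormalSeries} (hJ : euler J = 0) :
    ∃ g, euler g = 0 ∧ pderiv ℂ 1 (y₁ * g) = J ∧ constantCoeff g = constantCoeff J := by
  -- ∂₁(y₁g) = (1 + y₁∂₁)g, which is diagonal on monomials with eigenvalue m₁ + 1.
  refine ⟨ofCoeff fun m => coeff m J / (m 1 + 1), ?_, ?_, ?_⟩
  · rw [← zero_smul ℂ J] at hJ
    rw [← zero_smul ℂ (ofCoeff _)]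
    exact euler_eq_smul_of_coeff fun m hm => by
      simp [coeff_eq_zero_of_euler_eq_smul hJ hm]
  · rw [Derivation.leibniz, pderiv_one_y₁, smul_eq_mul, smul_eq_mul, mul_one]
    ext m
    rw [map_add, y₁, coeff_X_mul_pderiv, coeff_ofCoeff]
    have : (m 1 : ℂ) + 1 ≠ 0 := Nat.cast_add_one_ne_zero _
    field_simp
  · rw [← MvPowerSeries.coeff_zero_eq_constantCoeff_apply, coeff_ofCoeff]
    simp

theorem transvDiv_of_conj {Φ : Diffeo} {Y Z : VectorField} (hx : Φ x = x)
    (hJ : jac (Φ y₁) (Φ y₂) = 1) (hY : Y x = x ^ 2) (h : ∀ f, Y (Φ f) = Φ (Z f)) :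
    Φ (transvDiv Z) = transvDiv Y := by
  have := vectorField_jac_of_conj hx hY h
  rw [hJ, Derivation.map_one_eq_zero, mul_one] at this
  exact sub_eq_zero.1 this.symm

theorem transvDiv_eq_x_of_isSympConj {Y Z : VectorField} (hY : Y x = x ^ 2)
    (hd : transvDiv Y = x) (h : IsSympConj Y Z) : transvDiv Z = x := by
  obtain ⟨Φ, hx, hJ, hΦ⟩ := isSympConj_iff.1 h
  apply Φ.injective
  rw [transvDiv_of_conj hx hJ hY hΦ, hd, hx]

theorem y_mul_sub_mem {y g : FormalSeries} (hy : y ∈ 𝔪) (hg : constantCoeff g = 1) :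
    y * g - y ∈ 𝔪 ^ 2 := by
  have : y * g - y = y * (g - 1) := by ring
  rw [this, pow_two]
  exact Ideal.mul_mem_mul hy (by rw [mem_maximal_iff]; simp [hg])

/-- The Jacobian J of the normalizing map satisfies Z J = (x - div Z) J, where x - div Z has weight
zero and no constant term, so E J = 0. Then Θ = (x, y₁g, y₂) with ∂₁(y₁g) = J has Jacobian J and
commutes with E: composing with its inverse restores Jacobian 1 without losing resonance. -/
theorem PreparedWith.exists_symplectic_resonant {l : ℂ} (hl : l ≠ 0) {Y : VectorField}
    (hY : PreparedWith l Y) (hd : transvDiv Y = x) :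
    ∃ Z, ResonantWith l Z ∧ IsSympConj Y Z := by
  obtain ⟨Z, Ψ, hZ, hx, h1, h2, hΨ⟩ := hY.exists_resonant hl
  set J := jac (Ψ y₁) (Ψ y₂) with hJ
  have hJE : euler J = 0 := by
    have hr : Z J = (x - transvDiv Z) * J := by
      rw [hJ, vectorField_jac_of_conj hx hZ.apply_x hΨ, hd, hx]
    rw [hZ.euler_eq_smul hl (κ := 0) (by simp [hZ.euler_transvDiv])
      (by simp [hZ.constantCoeff_transvDiv]) hr, zero_smul]
  have hJ0 : constantCoeff J = 1 := by
    rw [hJ, jac, map_sub, map_mul, map_mul, constantCoeff_pderiv_eq 1 h1,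
      constantCoeff_pderiv_eq 2 h2, constantCoeff_pderiv_eq 2 h1, constantCoeff_pderiv_eq 1 h2]
    simp
  obtain ⟨g, hgE, hgJ, hg0⟩ := exists_pderiv_y₁_mul_eq hJE
  rw [hJ0] at hg0
  let Θ : Diffeo := tangentDiffeo (y₁ * g) y₂ (y_mul_sub_mem y₁_mem hg0) (by simp)
  have hΘx : Θ x = x := tangentDiffeo_x
  have hΘ1 : Θ y₁ = y₁ * g := tangentDiffeo_y₁
  have hΘ2 : Θ y₂ = y₂ := tangentDiffeo_y₂
  have hsx : Θ.symm x = x := by rw [AlgEquiv.symm_apply_eq, hΘx]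
  refine ⟨pushforward Θ Z, hZ.pushforward hΘx (by simp [hΘ1, hgE, mul_comm]) (by simp [hΘ2]),
    isSympConj_equivalence.symm (isSympConj_iff.2 ⟨Θ.symm * Ψ, ?_, ?_, fun f => ?_⟩)⟩
  · rw [AlgEquiv.mul_apply, hx, hsx]
  · have h3 := jac_diffeo hsx (Θ y₁) (Θ y₂)
    have h4 : jac (Θ y₁) (Θ y₂) = J := by
      rw [hΘ1, hΘ2, jac, hgJ]
      simp
    rw [h4, AlgEquiv.symm_apply_apply, AlgEquiv.symm_apply_apply] at h3
    rw [AlgEquiv.mul_apply, AlgEquiv.mul_apply, jac_diffeo hsx, ← hJ, ← h3]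
    simp [jac]
  · simp [AlgEquiv.mul_apply, hΨ]

/-! ### The components of a resonant vector field -/

/-- A monomial without y₁ has weight m₂ ≥ 0, which is never -1. -/
theorem exists_eq_y₁_mul {f : FormalSeries} (hf : euler f = -f) :
    ∃ g, f = y₁ * g ∧ euler g = 0 := by
  rw [← neg_one_smul ℂ f] at hf
  have hdvd : y₁ ∣ f := MvPowerSeries.X_dvd_iff.2 fun m hm =>
    coeff_eq_zero_of_euler_eq_smul hf (by
      rw [hm, Nat.cast_zero, sub_zero]
      intro h
      have := congrArg Complex.re h
      simp only [Complex.natCast_re, Complex.neg_re, Complex.one_re] at this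
      linarith [(m 2).cast_nonneg (α := ℝ)])
  obtain ⟨g, rfl⟩ := hdvd
  refine ⟨g, rfl, ?_⟩
  have hy : y₁ ≠ 0 := fun h => by simpa [h] using pderiv_one_y₁
  rw [Derivation.leibniz, euler_y₁, neg_one_smul, smul_eq_mul, smul_eq_mul] at hf
  refine (mul_eq_zero.1 (?_ : y₁ * euler g = 0)).resolve_left hy
  linear_combination hf

theorem exists_eq_y₂_mul {f : FormalSeries} (hf : euler f = f) :
    ∃ g, f = y₂ * g ∧ euler g = 0 := by
  rw [← one_smul ℂ f, Derivation.map_smul] at hf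
  rw [one_smul] at hf
  have hdvd : y₂ ∣ f := MvPowerSeries.X_dvd_iff.2 fun m hm =>
    coeff_eq_zero_of_euler_eq_smul hf (by
      rw [hm, Nat.cast_zero, zero_sub]
      intro h
      have := congrArg Complex.re h
      simp only [Complex.natCast_re, Complex.neg_re, Complex.one_re] at this
      linarith [(m 1).cast_nonneg (α := ℝ)])
  obtain ⟨g, rfl⟩ := hdvd
  refine ⟨g, rfl, ?_⟩
  have hy : y₂ ≠ 0 := fun h => by simpa [h] using pderiv_two_y₂
  rw [Derivation.leibniz, euler_y₂, one_smul, smul_eq_mul, smul_eq_mul] at hf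
  refine (mul_eq_zero.1 (?_ : y₂ * euler g = 0)).resolve_left hy
  linear_combination hf

theorem y₂_mul_pderiv_two_eq {f : FormalSeries} (hf : euler f = 0) :
    y₂ * pderiv ℂ 2 f = y₁ * pderiv ℂ 1 f := by
  rwa [euler_apply, sub_eq_zero] at hf

/-- Weight considerations give components A y₁ and B y₂ with A, B of weight zero. The divergence is
then (1 + y₁∂₁)(A + B), and injectivity of 1 + y₁∂₁ forces A + B = x. -/
theorem ResonantWith.exists_coefficient {l : ℂ} {Z : VectorField} (h : ResonantWith l Z)
    (hd : transvDiv Z = x) :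
    ∃ A, euler A = 0 ∧ constantCoeff A = -l ∧ Z y₁ = A * y₁ ∧ Z y₂ = (x - A) * y₂ := by
  obtain ⟨A, hA, hAE⟩ := exists_eq_y₁_mul h.euler_apply_y₁
  obtain ⟨B, hB, hBE⟩ := exists_eq_y₂_mul h.euler_apply_y₂
  have hAB : A + B - x = 0 := by
    have h1 : (A + B - x) + y₁ * pderiv ℂ 1 (A + B - x) = 0 := by
      rw [transvDiv, hA, hB, Derivation.leibniz, Derivation.leibniz] at hd
      simp only [smul_eq_mul, pderiv_one_y₁, pderiv_two_y₂, y₂_mul_pderiv_two_eq hBE] at hd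
      simp only [map_add, map_sub, pderiv_one_x]
      linear_combination hd
    ext m
    have h2 := congrArg (coeff m) h1
    rw [map_add, y₁, coeff_X_mul_pderiv, map_zero] at h2
    rw [map_zero]
    refine (mul_eq_zero.1 (?_ : ((m 1 : ℂ) + 1) * _ = 0)).resolve_left (Nat.cast_add_one_ne_zero _)
    linear_combination h2
  refine ⟨A, hAE, ?_, by rw [hA, mul_comm], ?_⟩
  · have h1 := constantCoeff_pderiv_eq (f := Z y₁) (g := -(l • y₁)) 1 (by simpa using h.apply_y₁)
    rw [hA, Derivation.leibniz] at h1
    simpa [MvPowerSeries.smul_eq_C_mul] using h1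
  · rw [hB]
    linear_combination y₂ * hAB

/-! ### One-variable series composed with elements of the maximal ideal -/

theorem hasSubst_of_mem {w : FormalSeries} (hw : w ∈ 𝔪) : PowerSeries.HasSubst w :=
  PowerSeries.HasSubst.of_constantCoeff_zero hw

/-- The same `c'` serves all `w`, which lets inductions compare substitutions at `w` and at `Φ w`.
-/
theorem exists_subst_eq (c : PowerSeries ℂ) : ∃ c' : PowerSeries ℂ, ∀ w ∈ 𝔪,
    PowerSeries.subst w c = algebraMap ℂ FormalSeries (PowerSeries.constantCoeff c) +
      w * PowerSeries.subst w c' := by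
  refine ⟨PowerSeries.mk fun p => PowerSeries.coeff (p + 1) c, fun w hw => ?_⟩
  conv_lhs => rw [PowerSeries.eq_X_mul_shift_add_const c]
  rw [PowerSeries.subst_add (hasSubst_of_mem hw), PowerSeries.subst_mul (hasSubst_of_mem hw),
    PowerSeries.subst_X (hasSubst_of_mem hw), PowerSeries.subst_C, add_comm]
  rfl

theorem diffeo_subst (Φ : Diffeo) {w : FormalSeries} (hw : w ∈ 𝔪) (c : PowerSeries ℂ) :
    Φ (PowerSeries.subst w c) = PowerSeries.subst (Φ w) c := by
  suffices H : ∀ n (c : PowerSeries ℂ),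
      Φ (PowerSeries.subst w c) - PowerSeries.subst (Φ w) c ∈ 𝔪 ^ n from
    sub_eq_zero.1 (eq_zero_of_forall_mem_pow fun n => H n c)
  intro n
  induction n with
  | zero => intro c; simp
  | succ n ih =>
    intro c
    obtain ⟨c', hc⟩ := exists_subst_eq c
    have hΦ := diffeo_mem_maximal Φ hw
    rw [hc w hw, hc _ hΦ, map_add, AlgEquiv.commutes, map_mul, add_sub_add_left_eq_sub, ← mul_sub,
      pow_succ']
    exact Ideal.mul_mem_mul hΦ (ih c')

theorem euler_subst {w : FormalSeries} (hw : w ∈ 𝔪) (hE : euler w = 0) (c : PowerSeries ℂ) :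
    euler (PowerSeries.subst w c) = 0 := by
  suffices H : ∀ n (c : PowerSeries ℂ), euler (PowerSeries.subst w c) ∈ 𝔪 ^ n from
    eq_zero_of_forall_mem_pow fun n => H n c
  intro n
  induction n with
  | zero => intro c; simp
  | succ n ih =>
    intro c
    obtain ⟨c', hc⟩ := exists_subst_eq c
    rw [hc w hw, map_add, Derivation.map_algebraMap, Derivation.leibniz, hE, zero_add, smul_zero,
      add_zero, smul_eq_mul, pow_succ']
    exact Ideal.mul_mem_mul hw (ih c')

theorem y₁_mul_y₂_mem : y₁ * y₂ ∈ 𝔪 := Ideal.mul_mem_right _ _ y₁_mem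

theorem euler_y₁_mul_y₂ : euler (y₁ * y₂) = 0 := by
  rw [Derivation.leibniz, euler_y₁, euler_y₂, smul_eq_mul, smul_eq_mul]
  ring

@[simp] theorem euler_atV (c : VSeries) : euler (atV c) = 0 :=
  euler_subst y₁_mul_y₂_mem euler_y₁_mul_y₂ _

theorem atV_mem (c : VSeries) : atV c ∈ 𝔪 := by
  obtain ⟨c', hc⟩ := exists_subst_eq c.1
  rw [atV, hc _ y₁_mul_y₂_mem, c.2, map_zero, zero_add]
  exact Ideal.mul_mem_right _ _ y₁_mul_y₂_mem

@[simp] theorem constantCoeff_atV (c : VSeries) : constantCoeff (atV c) = 0 := atV_mem c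

/-- The exponent of the monomial `(y₁ y₂)^j`. -/
def diagExp (j : ℕ) : Fin 3 →₀ ℕ := Finsupp.single 1 j + Finsupp.single 2 j

@[simp] theorem diagExp_zero (j : ℕ) : diagExp j 0 = 0 := by simp [diagExp]
@[simp] theorem diagExp_one (j : ℕ) : diagExp j 1 = j := by simp [diagExp]
@[simp] theorem diagExp_two (j : ℕ) : diagExp j 2 = j := by simp [diagExp]

theorem diagExp_injective : Function.Injective diagExp := fun i j h => by
  simpa using congrArg (fun m => m 1) h

theorem eq_diagExp {m : Fin 3 →₀ ℕ} (h0 : m 0 = 0) (h : m 1 = m 2) : m = diagExp (m 1) := by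
  ext i
  fin_cases i
  · simpa using h0
  · simp
  · simpa using h.symm

theorem coeff_diagExp_subst (c : PowerSeries ℂ) (j : ℕ) :
    coeff (diagExp j) (PowerSeries.subst (y₁ * y₂) c : FormalSeries) = PowerSeries.coeff j c := by
  have hpow : ∀ k, (y₁ * y₂) ^ k = MvPowerSeries.monomial (diagExp k) (1 : ℂ) := fun k => by
    rw [mul_pow, y₁, y₂, MvPowerSeries.X_pow_eq, MvPowerSeries.X_pow_eq,
      MvPowerSeries.monomial_mul_monomial, one_mul, diagExp]
  rw [PowerSeries.coeff_subst (hasSubst_of_mem y₁_mul_y₂_mem), finsum_eq_single _ j]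
  · simp [hpow]
  · intro k hk
    rw [hpow, MvPowerSeries.coeff_monomial_ne (fun h => hk (diagExp_injective h).symm), smul_zero]

theorem coeff_diagExp_atV (c : VSeries) (j : ℕ) :
    coeff (diagExp j) (atV c) = PowerSeries.coeff j c.1 := coeff_diagExp_subst _ _

theorem eq_of_euler_eq_zero {f : FormalSeries} (hf : euler f = 0) {m : Fin 3 →₀ ℕ}
    (hm : coeff m f ≠ 0) : m 1 = m 2 := by
  by_contra h
  rw [← zero_smul ℂ f] at hf
  refine hm (coeff_eq_zero_of_euler_eq_smul hf ?_)
  rw [sub_ne_zero]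
  exact fun e => h (by exact_mod_cast e.symm)

/-- A series of weight zero vanishes on `x = 0` if its coefficients on the powers of `y₁ y₂`
vanish. -/
theorem x_dvd_of_euler_eq_zero {f : FormalSeries} (hf : euler f = 0)
    (h : ∀ j, coeff (diagExp j) f = 0) : x ∣ f :=
  MvPowerSeries.X_dvd_iff.2 fun m hm => by
    by_contra hne
    rw [eq_diagExp hm (eq_of_euler_eq_zero hf hne)] at hne
    exact hne (h _)

theorem x_ne_zero : x ≠ 0 := fun h => by simpa [h] using pderiv_zero_x

/-! ### Normal forms -/

/-- The coefficient `-λ + a₁ x - c(y₁ y₂)` of a normal form. -/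
def normalCoeff (p : Param) : FormalSeries :=
  -MvPowerSeries.C (p.1 : ℂ) + MvPowerSeries.C p.2.1.1.1 * x - atV p.2.2

@[simp] theorem normalForm_x (p : Param) : normalForm p x = x ^ 2 := ofComponents_x _ _ _

theorem normalForm_y₁ (p : Param) : normalForm p y₁ = normalCoeff p * y₁ := ofComponents_y₁ _ _ _

theorem normalForm_y₂ (p : Param) : normalForm p y₂ = (x - normalCoeff p) * y₂ := by
  rw [normalForm, ofComponents_y₂, normalCoeff]
  have h : (MvPowerSeries.C p.2.1.1.1 : FormalSeries) + MvPowerSeries.C p.2.1.1.2 = 1 := by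
    rw [← map_add, p.2.1.2, map_one]
  linear_combination x * y₂ * h

@[simp] theorem derivation_C (D : VectorField) (a : ℂ) :
    D (MvPowerSeries.C a : FormalSeries) = 0 := D.map_algebraMap a

@[simp] theorem diffeo_C (Φ : Diffeo) (a : ℂ) :
    Φ (MvPowerSeries.C a : FormalSeries) = MvPowerSeries.C a := Φ.commutes a

@[simp] theorem euler_normalCoeff (p : Param) : euler (normalCoeff p) = 0 := by
  simp [normalCoeff]

@[simp] theorem constantCoeff_normalCoeff (p : Param) :
    constantCoeff (normalCoeff p) = -(p.1 : ℂ) := by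
  simp [normalCoeff]

theorem normalForm_preparedWith (p : Param) : PreparedWith p.1 (normalForm p) := by
  refine ⟨normalForm_x p, ?_, ?_⟩
  · have e : normalForm p y₁ + (p.1 : ℂ) • y₁ =
        (normalCoeff p + MvPowerSeries.C (p.1 : ℂ)) * y₁ := by
      rw [normalForm_y₁, MvPowerSeries.smul_eq_C_mul]
      ring
    rw [e, pow_two]
    exact Ideal.mul_mem_mul (by simp [mem_maximal_iff]) y₁_mem
  · have e : normalForm p y₂ - (p.1 : ℂ) • y₂ =
        (x - normalCoeff p - MvPowerSeries.C (p.1 : ℂ)) * y₂ := by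
      rw [normalForm_y₂, MvPowerSeries.smul_eq_C_mul]
      ring
    rw [e, pow_two]
    exact Ideal.mul_mem_mul (by simp [mem_maximal_iff]) y₂_mem

theorem normalForm_resonantWith (p : Param) : ResonantWith p.1 (normalForm p) := by
  refine ⟨normalForm_preparedWith p, ?_, ?_⟩
  · rw [normalForm_y₁, Derivation.leibniz, euler_normalCoeff]
    simp
  · rw [normalForm_y₂, Derivation.leibniz, map_sub, euler_normalCoeff]
    simp

/-- On weight zero y₂∂₂ = y₁∂₁, so the two diagonal coefficients only enter through their sum x; the
action is independent of `p`. -/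
theorem normalForm_apply_of_euler_eq_zero (p : Param) {f : FormalSeries} (hf : euler f = 0) :
    normalForm p f = x * (x * pderiv ℂ 0 f + y₁ * pderiv ℂ 1 f) := by
  rw [vectorField_apply, normalForm_x, normalForm_y₁, normalForm_y₂, mul_assoc _ y₂,
    y₂_mul_pderiv_two_eq hf]
  ring

theorem transvDiv_normalForm (p : Param) : transvDiv (normalForm p) = x := by
  rw [transvDiv, normalForm_y₁, normalForm_y₂]
  simp only [Derivation.leibniz, map_sub, smul_eq_mul, pderiv_one_y₁, pderiv_two_y₂, pderiv_two_x]
  linear_combination -y₂_mul_pderiv_two_eq (euler_normalCoeff p)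

theorem normalForm_mem_saddleNodes (p : Param) : normalForm p ∈ saddleNodes :=
  ⟨(isTransvHamiltonian_iff (normalForm_x p)).2
      ⟨(normalForm_preparedWith p).isSingular, transvDiv_normalForm p⟩,
    normalForm p, isSympConj_equivalence.refl _,
    isPrepared_iff.2 ⟨p.1, p.1.ne_zero, normalForm_preparedWith p⟩⟩

/-! ### Reduction of resonant vector fields to normal forms -/

/-- The equation `(x ∂/∂x + y₁ ∂/∂y₁) g = h g` with `g(0) = 1`, in weight zero. -/
theorem exists_multiplier {h : FormalSeries} (hE : euler h = 0) (h0 : constantCoeff h = 0) :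
    ∃ g, euler g = 0 ∧ constantCoeff g = 1 ∧ x * pderiv ℂ 0 g + y₁ * pderiv ℂ 1 g = h * g := by
  -- `L` inverts x∂ₓ + y₁∂₁ on weight zero. At m = 0 division by zero returns 0, so the fixed point
  -- of f ↦ 1 + L(hf) keeps constant term 1.
  let L : FormalSeries → FormalSeries := fun f =>
    ofCoeff fun m => if m 1 = m 2 then coeff m f / (m 0 + m 1) else 0
  have hL : ∀ f m, coeff m (L f) = if m 1 = m 2 then coeff m f / (m 0 + m 1) else 0 :=
    fun f m => rfl
  obtain ⟨G, hG⟩ := exists_fixedPoint (ι := Unit) (fun f i => 1 + L (h * f i)) (by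
    intro n f g hfg i
    have := mem_pow_iff.1 (mul_mem_pow (a := 1) (n := n + 1) (by simpa using mem_maximal_iff.2 h0)
      (hfg i) (by omega))
    rw [mem_pow_iff]
    intro m hm
    have h1 := this m hm
    rw [mul_sub, map_sub, sub_eq_zero] at h1
    rw [map_sub, map_add, map_add, hL, hL, h1, sub_self])
  have hg : 1 + L (h * G ()) = G () := congrFun hG ()
  set g := G ()
  have hgE : euler g = 0 := by
    rw [← zero_smul ℂ g]
    refine euler_eq_smul_of_coeff fun m hm => ?_
    have hm' : m 1 ≠ m 2 := fun e => hm (by rw [e, sub_self])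
    have hm0 : m ≠ 0 := fun e => hm' (by simp [e])
    rw [← hg, map_add, hL, if_neg hm', MvPowerSeries.coeff_one, if_neg hm0, add_zero]
  refine ⟨g, hgE, ?_, ?_⟩
  · rw [← hg, ← MvPowerSeries.coeff_zero_eq_constantCoeff_apply, map_add, hL]
    simp [h0]
  · ext m
    have hhg : euler (h * g) = 0 := by rw [Derivation.leibniz, hE, hgE]; simp
    rw [map_add, x, y₁, coeff_X_mul_pderiv, coeff_X_mul_pderiv, ← add_mul]
    by_cases hm : m 1 = m 2
    · by_cases hm0 : m 0 + m 1 = 0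
      · have : m = 0 := by
          ext i
          fin_cases i
          · simp; omega
          · simp; omega
          · simp; omega
        subst this
        simp [h0]
      · have hne : (m 0 : ℂ) + m 1 ≠ 0 := by exact_mod_cast hm0
        have hm1 : m ≠ 0 := fun e => hm0 (by simp [e])
        conv_lhs => rw [← hg, map_add, hL, if_pos hm, MvPowerSeries.coeff_one, if_neg hm1]
        field_simp
        ring
    · have h1 : coeff m g = 0 := by
        by_contra hne
        exact hm (eq_of_euler_eq_zero hgE hne)
      have h2 : coeff m (h * g) = 0 := by
        by_contra hne
        exact hm (eq_of_euler_eq_zero hhg hne)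
      rw [h1, h2, mul_zero]

/-- Take a₁ to be the coefficient of x in A and -c the part of A in v alone, without its constant
term. What remains is divisible by x, with quotient vanishing at 0. -/
theorem exists_normalCoeff {l : ℂˣ} {A : FormalSeries} (hE : euler A = 0)
    (h0 : constantCoeff A = -(l : ℂ)) :
    ∃ (p : Param) (h : FormalSeries), p.1 = l ∧ normalCoeff p - A = x * h ∧ euler h = 0 ∧
      constantCoeff h = 0 := by
  let a : ℂ := coeff (Finsupp.single 0 1) A
  let c : VSeries := ⟨PowerSeries.mk fun j => if j = 0 then 0 else -coeff (diagExp j) A, by simp⟩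
  let p : Param := (l, ⟨(a, 1 - a), by simp⟩, c)
  have hdE : euler (normalCoeff p - A) = 0 := by rw [map_sub, hE]; simp
  have hdiag : ∀ j, coeff (diagExp j) (normalCoeff p - A) = 0 := by
    intro j
    rcases Nat.eq_zero_or_pos j with rfl | hj
    · have : diagExp 0 = 0 := by simp [diagExp]
      rw [this, MvPowerSeries.coeff_zero_eq_constantCoeff_apply, map_sub, h0]
      simp [p]
    · have hne : diagExp j ≠ 0 := fun e => by
        have := congrArg (fun m => m 1) e
        simp at this
        omega
      have hx : coeff (diagExp j) (MvPowerSeries.C a * x) = 0 := by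
        rw [MvPowerSeries.coeff_C_mul, x, ← mul_one (X 0 : FormalSeries), coeff_X_mul]
        simp
      have hC : coeff (diagExp j) (MvPowerSeries.C (l : ℂ) : FormalSeries) = 0 := by
        classical
        rw [MvPowerSeries.coeff_C, if_neg hne]
      change coeff (diagExp j) (-MvPowerSeries.C (l : ℂ) + MvPowerSeries.C a * x - atV c - A) = 0
      rw [map_sub, map_sub, map_add, map_neg, hx, hC, coeff_diagExp_atV]
      simp [c, hj.ne']
  obtain ⟨h, hh⟩ := x_dvd_of_euler_eq_zero hdE hdiag
  refine ⟨p, h, rfl, hh, ?_, ?_⟩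
  · rw [hh, Derivation.leibniz, euler_x, smul_zero, add_zero, smul_eq_mul] at hdE
    exact (mul_eq_zero.1 hdE).resolve_left x_ne_zero
  · have h1 := congrArg (fun f => constantCoeff (pderiv ℂ 0 f)) hh
    have h2 : constantCoeff (pderiv ℂ 0 A) = a := by
      rw [← MvPowerSeries.coeff_zero_eq_constantCoeff_apply, MvPowerSeries.coeff_pderiv]
      simp [a]
    have h3 : constantCoeff (pderiv ℂ 0 (atV c)) = 0 := by
      obtain ⟨c', hc⟩ := exists_subst_eq c.1
      rw [atV, hc _ y₁_mul_y₂_mem]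
      simp
    simp only [normalCoeff, map_sub, map_add, map_neg, derivation_C, Derivation.leibniz, h2,
      smul_eq_mul, pderiv_zero_x, map_mul, map_one, constantCoeff_x, map_zero] at h1
    have h4 : constantCoeff (pderiv ℂ 0 (atV p.2.2)) = 0 := h3
    rw [h4] at h1
    simp [p] at h1
    exact h1.symm

/-- Formally, the product v is unchanged and dlog(y₁g) ∧ dlog(y₂/g) differs from dlog y₁ ∧ dlog y₂
by dlog g ∧ dlog v, zero modulo dx because g depends on x and v only. -/
theorem jac_y₁_mul_y₂_mul {g q : FormalSeries} (hg : euler g = 0) (hq : euler q = 0)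
    (hgq : g * q = 1) : jac (y₁ * g) (y₂ * q) = 1 := by
  have h1 := y₂_mul_pderiv_two_eq hg
  have h2 := y₂_mul_pderiv_two_eq hq
  have h3 := congrArg (fun f => y₁ * pderiv ℂ 1 f) hgq
  simp only [Derivation.leibniz, smul_eq_mul, MvPowerSeries.pderiv_one, mul_zero] at h3
  simp only [jac, Derivation.leibniz, smul_eq_mul, pderiv_one_y₁, pderiv_one_y₂, pderiv_two_y₁,
    pderiv_two_y₂]
  linear_combination hgq + h3 + g * h2 + y₁ * pderiv ℂ 1 g * h2 - y₁ * pderiv ℂ 1 q * h1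

/-- The map (x, y₁g, y₂/g) fixes x and v, hence `normalCoeff p`, while Z(y₁g) = (A + Zg/g) y₁g; the
multiplier equation gives Zg/g = `normalCoeff p - A`. -/
theorem ResonantWith.exists_isSympConj_normalForm {l : ℂˣ} {Z : VectorField}
    (hZ : ResonantWith l Z) (hd : transvDiv Z = x) : ∃ p, IsSympConj Z (normalForm p) := by
  obtain ⟨A, hAE, hA0, hA1, hA2⟩ := hZ.exists_coefficient hd
  obtain ⟨p, h, -, hp, hhE, hh0⟩ := exists_normalCoeff hAE hA0
  obtain ⟨g, hgE, hg0, hg⟩ := exists_multiplier hhE hh0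
  obtain ⟨q, hgq⟩ := (isUnit_iff_constantCoeff_ne_zero.2
    (by simp [hg0] : constantCoeff g ≠ 0)).exists_right_inv
  have hgne : g ≠ 0 := fun e => by simp [e] at hg0
  have cancel : ∀ D : VectorField, g * D q + q * D g = 0 := fun D => by
    have := congrArg D hgq
    rwa [Derivation.leibniz, Derivation.map_one_eq_zero] at this
  have hqE : euler q = 0 := by
    have := cancel euler
    rw [hgE, mul_zero, add_zero] at this
    exact (mul_eq_zero.1 this).resolve_left hgne
  have hq0 : constantCoeff q = 1 := by
    have := congrArg constantCoeff hgq
    simpa [hg0] using this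
  have hZg : Z g = (normalCoeff p - A) * g := by
    rw [vectorField_apply, hZ.apply_x, hA1, hA2, mul_assoc _ y₂, y₂_mul_pderiv_two_eq hgE, hp]
    linear_combination x * hg
  have hZq : Z q = -(normalCoeff p - A) * q := by
    have := cancel Z
    rw [hZg] at this
    refine mul_left_cancel₀ hgne ?_
    linear_combination this
  let Ξ : Diffeo := tangentDiffeo (y₁ * g) (y₂ * q) (y_mul_sub_mem y₁_mem hg0)
    (y_mul_sub_mem y₂_mem hq0)
  have hΞx : Ξ x = x := tangentDiffeo_x
  have hΞ1 : Ξ y₁ = y₁ * g := tangentDiffeo_y₁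
  have hΞ2 : Ξ y₂ = y₂ * q := tangentDiffeo_y₂
  have hΞv : Ξ (y₁ * y₂) = y₁ * y₂ := by
    rw [map_mul, hΞ1, hΞ2]
    linear_combination y₁ * y₂ * hgq
  have hΞc : Ξ (normalCoeff p) = normalCoeff p := by
    simp only [normalCoeff, map_sub, map_add, map_neg, map_mul, diffeo_C, hΞx, atV,
      diffeo_subst Ξ y₁_mul_y₂_mem, hΞv]
  refine ⟨p, isSympConj_iff.2 ⟨Ξ, hΞx, ?_, forall_conj_of_coordinates ?_ ?_ ?_⟩⟩
  · rw [hΞ1, hΞ2, jac_y₁_mul_y₂_mul hgE hqE hgq]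
  · rw [hΞx, hZ.apply_x, normalForm_x, map_pow, hΞx]
  · rw [hΞ1, normalForm_y₁, map_mul Ξ, hΞc, hΞ1, Derivation.leibniz, hA1, hZg]
    simp only [smul_eq_mul]
    ring
  · rw [hΞ2, normalForm_y₂, map_mul Ξ, map_sub, hΞc, hΞ2, hΞx, Derivation.leibniz, hA2, hZq]
    simp only [smul_eq_mul]
    ring

theorem exists_isSympConj_normalForm {Y : VectorField} (hY : Y ∈ saddleNodes) :
    ∃ p, IsSympConj Y (normalForm p) := by
  obtain ⟨hH, W, hYW, hW⟩ := hY
  obtain ⟨l, hl, hWl⟩ := isPrepared_iff.1 hW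
  have hYx : Y x = x ^ 2 := by
    obtain ⟨Φ, hx, -, hΦ⟩ := isSympConj_iff.1 hYW
    have := hΦ x
    rwa [hx, hWl.apply_x, map_pow, hx] at this
  have hWd := transvDiv_eq_x_of_isSympConj hYx ((isTransvHamiltonian_iff hYx).1 hH).2 hYW
  obtain ⟨Z, hZ, hWZ⟩ := hWl.exists_symplectic_resonant hl hWd
  have hZd := transvDiv_eq_x_of_isSympConj hWl.apply_x hWd hWZ
  obtain ⟨p, hp⟩ := ResonantWith.exists_isSympConj_normalForm (l := Units.mk0 l hl) hZ hZd
  exact ⟨p, isSympConj_equivalence.trans hYW (isSympConj_equivalence.trans hWZ hp)⟩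

/-! ### The involution -/

/-- The linear diffeomorphism with components `x`, `y₂`, `-y₁`. -/
def quarterTurn : Diffeo :=
  have h₁ : ∀ i, ![x, y₂, -y₁] i ∈ 𝔪 := fun i => by
    fin_cases i
    · exact x_mem
    · exact y₂_mem
    · exact neg_mem y₁_mem
  have h₂ : ∀ i, ![x, -y₂, y₁] i ∈ 𝔪 := fun i => by
    fin_cases i
    · exact x_mem
    · exact neg_mem y₂_mem
    · exact y₁_mem
  have key : ∀ (u v : Fin 3 → FormalSeries) (hu : ∀ i, u i ∈ 𝔪) (hv : ∀ i, v i ∈ 𝔪),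
      (∀ i, substHom u hu (v i) = X i) →
      (substHom u hu).comp (substHom v hv) = AlgHom.id ℂ FormalSeries := fun u v hu hv h =>
    (algHom_ext (fun i => X_mem_maximal i) fun i => by
      rw [AlgHom.comp_apply, substHom_X, h]; rfl).symm
  AlgEquiv.ofAlgHom (substHom _ h₁) (substHom _ h₂)
    (key _ _ _ _ fun i => by
      fin_cases i
      · change substHom _ h₁ x = x
        simp
      · change substHom _ h₁ (-y₂) = y₁
        simp
      · change substHom _ h₁ y₁ = y₂
        simp)
    (key _ _ _ _ fun i => by
      fin_cases i
      · change substHom _ h₂ x = x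
        simp
      · change substHom _ h₂ y₂ = y₁
        simp
      · change substHom _ h₂ (-y₁) = y₂
        simp)

@[simp] theorem quarterTurn_x : quarterTurn x = x := by simp [quarterTurn]
@[simp] theorem quarterTurn_y₁ : quarterTurn y₁ = y₂ := by simp [quarterTurn]
@[simp] theorem quarterTurn_y₂ : quarterTurn y₂ = -y₁ := by simp [quarterTurn]

/-- The quarter turn sends v to -v, whence the -c(-v) in the involution. -/
theorem quarterTurn_atV_flip (p : Param) : quarterTurn (atV (flip p).2.2) = -atV p.2.2 := by
  have hv : quarterTurn (y₁ * y₂) = -(y₁ * y₂) := by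
    rw [map_mul, quarterTurn_y₁, quarterTurn_y₂]
    ring
  have hm := neg_mem y₁_mul_y₂_mem
  have hsX : PowerSeries.HasSubst ((-1 : ℂ) • PowerSeries.X : PowerSeries ℂ) :=
    PowerSeries.HasSubst.smul_X' (-1)
  rw [atV, atV, diffeo_subst _ y₁_mul_y₂_mem, hv, flip]
  simp only
  rw [← PowerSeries.coe_substAlgHom (hasSubst_of_mem hm), map_neg,
    PowerSeries.coe_substAlgHom (hasSubst_of_mem hm), PowerSeries.rescale_eq_subst,
    PowerSeries.subst_comp_subst_apply hsX (hasSubst_of_mem hm),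
    PowerSeries.subst_smul (hasSubst_of_mem hm), PowerSeries.subst_X (hasSubst_of_mem hm)]
  simp

theorem quarterTurn_normalCoeff_flip (p : Param) :
    quarterTurn (normalCoeff (flip p)) = x - normalCoeff p := by
  have h : (MvPowerSeries.C p.2.1.1.1 : FormalSeries) + MvPowerSeries.C p.2.1.1.2 = 1 := by
    rw [← map_add, p.2.1.2, map_one]
  rw [normalCoeff, map_sub, quarterTurn_atV_flip, map_add, map_neg, map_mul, diffeo_C, diffeo_C,
    quarterTurn_x, normalCoeff]
  simp only [flip, Units.val_neg, map_neg]
  linear_combination x * h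

theorem isSympConj_flip (p : Param) : IsSympConj (normalForm p) (normalForm (flip p)) := by
  refine isSympConj_iff.2 ⟨quarterTurn, quarterTurn_x, ?_, forall_conj_of_coordinates ?_ ?_ ?_⟩
  · simp [jac]
  · simp
  · rw [normalForm_y₁, map_mul, quarterTurn_normalCoeff_flip, quarterTurn_y₁, normalForm_y₂]
  · rw [normalForm_y₂, map_mul, map_sub, quarterTurn_normalCoeff_flip, quarterTurn_y₂,
      quarterTurn_x, map_neg, normalForm_y₁]
    ring

/-! ### Uniqueness of the normal form -/

theorem constantCoeff_euler (f : FormalSeries) : constantCoeff (euler f) = 0 := by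
  simp [euler_apply]

/-- Compare terms of degree one: λE multiplies the y₁ and y₂ terms of `u` by -λ and λ, and `r`
multiplies both by κ because `u` has no constant term. -/
theorem PreparedWith.linear_part {l κ : ℂ} {Z : VectorField} (hZ : PreparedWith l Z)
    {u r : FormalSeries} (hu : u ∈ 𝔪) (hr : constantCoeff r = κ) (h : Z u = r * u) :
    (κ + l) * constantCoeff (pderiv ℂ 1 u) = 0 ∧ (κ - l) * constantCoeff (pderiv ℂ 2 u) = 0 := by
  have hm : Z u - l • euler u ∈ 𝔪 ^ 2 := hZ.sub_euler_mem_pow (n := 1) (by simpa using hu)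
  have h1 := constantCoeff_pderiv_eq 1 hm
  have h2 := constantCoeff_pderiv_eq 2 hm
  have e1 := congrArg constantCoeff (euler_pderiv_one u)
  have e2 := congrArg constantCoeff (euler_pderiv_two u)
  rw [map_add, constantCoeff_euler] at e1
  rw [map_sub, constantCoeff_euler] at e2
  have hu0 : constantCoeff u = 0 := hu
  rw [h, Derivation.leibniz, Derivation.map_smul, MvPowerSeries.smul_eq_C_mul] at h1 h2
  simp only [smul_eq_mul, map_add, map_mul, hr, hu0, MvPowerSeries.constantCoeff_C] at h1 h2
  constructor
  · linear_combination h1 - l * e1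
  · linear_combination h2 - l * e2

theorem eigenvalue_eq_or_eq_neg {p q : Param} (h : IsSympConj (normalForm p) (normalForm q)) :
    q.1 = p.1 ∨ q.1 = -p.1 := by
  obtain ⟨Φ, hx, hJ, hΦ⟩ := isSympConj_iff.1 h
  have h1 : normalForm p (Φ y₁) = Φ (normalCoeff q) * Φ y₁ := by
    rw [hΦ, normalForm_y₁, map_mul]
  have hl := (normalForm_preparedWith p).linear_part (diffeo_mem_maximal Φ y₁_mem)
    (by rw [constantCoeff_diffeo, constantCoeff_normalCoeff]) h1
  have hJ0 := congrArg constantCoeff hJ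
  rw [jac, map_sub, map_mul, map_mul, map_one] at hJ0
  rcases mul_eq_zero.1 hl.1 with ha | ha
  · left
    ext
    linear_combination -ha
  · right
    rcases mul_eq_zero.1 hl.2 with hb | hb
    · ext
      rw [Units.val_neg]
      linear_combination -hb
    -- If neither eigenvalue matched, Φ y₁ would have no linear term in y₁, y₂, contradicting
    -- Jacobian 1.
    · rw [ha, hb] at hJ0
      simp at hJ0

/-- A series `f` of weight zero and order at least two with `(x ∂/∂x + y₁ ∂/∂y₁) f = f` is a
multiple of `y₁ y₂`. -/
theorem eq_smul_y₁_mul_y₂ {f : FormalSeries} (hE : euler f = 0) (hf : f ∈ 𝔪 ^ 2)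
    (h : x * pderiv ℂ 0 f + y₁ * pderiv ℂ 1 f = f) :
    f = MvPowerSeries.C (coeff (diagExp 1) f) * (y₁ * y₂) := by
  have hv : y₁ * y₂ = MvPowerSeries.monomial (diagExp 1) (1 : ℂ) := by
    rw [y₁, y₂, MvPowerSeries.X, MvPowerSeries.X, MvPowerSeries.monomial_mul_monomial, one_mul,
      diagExp]
  ext m
  rw [MvPowerSeries.coeff_C_mul, hv]
  classical
  rw [MvPowerSeries.coeff_monomial]
  split_ifs with hm
  · rw [hm, mul_one]
  · rw [mul_zero]
    by_contra hne
    have h1 := congrArg (coeff m) h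
    rw [map_add, x, y₁, coeff_X_mul_pderiv, coeff_X_mul_pderiv, ← add_mul] at h1
    have h2 : (m 0 : ℂ) + m 1 = 1 := mul_right_cancel₀ hne (by rw [h1, one_mul])
    have h3 : m 0 + m 1 = 1 := by exact_mod_cast h2
    have h4 := eq_of_euler_eq_zero hE hne
    by_cases h0 : m 0 = 0
    · apply hm
      rw [eq_diagExp h0 h4]
      congr 1
      omega
    -- The only other monomial allowed by the equation is x, excluded by the order of `f`.
    · refine hne (mem_pow_iff.1 hf m ?_)
      rw [Finsupp.degree_eq_sum, Fin.sum_univ_three]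
      omega

theorem eq_of_isSympConj {p q : Param} (hpq : q.1 = p.1)
    (h : IsSympConj (normalForm p) (normalForm q)) : q = p := by
  obtain ⟨Φ, hx, hJ, hΦ⟩ := isSympConj_iff.1 h
  have hp := normalForm_resonantWith p
  have hp0 : (p.1 : ℂ) ≠ 0 := p.1.ne_zero
  have m1 := diffeo_mem_maximal Φ y₁_mem
  have m2 := diffeo_mem_maximal Φ y₂_mem
  have h1 : normalForm p (Φ y₁) = Φ (normalCoeff q) * Φ y₁ := by
    rw [hΦ, normalForm_y₁, map_mul]
  have h2 : normalForm p (Φ y₂) = (x - Φ (normalCoeff q)) * Φ y₂ := by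
    rw [hΦ, normalForm_y₂, map_mul, map_sub, hx]
  have hr0 : constantCoeff (Φ (normalCoeff q)) = -(p.1 : ℂ) := by
    rw [constantCoeff_diffeo, constantCoeff_normalCoeff, hpq]
  set v := Φ (y₁ * y₂) with hv
  have hv' : v = Φ y₁ * Φ y₂ := by rw [hv, map_mul]
  have hZv : normalForm p v = x * v := by
    rw [hv', Derivation.leibniz, h1, h2]
    simp only [smul_eq_mul]
    ring
  have hvE : euler v = 0 := by
    rw [hp.euler_eq_smul hp0 (κ := 0) euler_x (by simp) hZv, zero_smul]
  have hvm : v ∈ 𝔪 ^ 2 := by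
    rw [hv', pow_two]
    exact Ideal.mul_mem_mul m1 m2
  have hvβ := eq_smul_y₁_mul_y₂ hvE hvm (mul_left_cancel₀ x_ne_zero (by
    rw [← normalForm_apply_of_euler_eq_zero p hvE, hZv]))
  set β := coeff (diagExp 1) v with hβ
  have hl := hp.linear_part m1 hr0 h1
  have ha2 : constantCoeff (pderiv ℂ 2 (Φ y₁)) = 0 := by
    refine (mul_eq_zero.1 hl.2).resolve_left ?_
    intro e
    exact hp0 (by linear_combination -(1 / 2 : ℂ) * e)
  have hJ0 := congrArg constantCoeff hJ
  rw [jac, map_sub, map_mul, map_mul, map_one, ha2, zero_mul, sub_zero] at hJ0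
  -- ∂₁∂₂ at the origin of Φ y₁ · Φ y₂ = βv expresses β through linear parts; as Φ y₁ has no linear
  -- y₂ term, this is the Jacobian at 0.
  have hβ1 : β = 1 := by
    have e := congrArg (fun f => constantCoeff (pderiv ℂ 1 (pderiv ℂ 2 f))) (hv'.symm.trans hvβ)
    have c1 : constantCoeff (Φ y₁) = 0 := m1
    have c2 : constantCoeff (Φ y₂) = 0 := m2
    simp only [Derivation.leibniz, smul_eq_mul, map_add, map_mul, c1, c2, ha2, derivation_C,
      pderiv_two_y₁, pderiv_two_y₂, pderiv_one_y₁, pderiv_one_y₂] at e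
    simp at e
    rw [← e, ← hJ0]
    ring
  have hvv : v = y₁ * y₂ := by rw [hvβ, hβ1, map_one, one_mul]
  have hc : Φ (normalCoeff q) = normalCoeff q := by
    simp only [normalCoeff, map_sub, map_add, map_neg, map_mul Φ (MvPowerSeries.C _), diffeo_C, hx,
      atV, diffeo_subst Φ y₁_mul_y₂_mem, ← hv, hvv]
  rw [hc] at h1 hr0
  have huE : euler (Φ y₁) = -Φ y₁ := by
    rw [hp.euler_eq_smul hp0 (κ := -1) (euler_normalCoeff q) (by rw [hr0]; ring) h1, neg_one_smul]
  obtain ⟨g, hg, hgE⟩ := exists_eq_y₁_mul huE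
  have hg0 : constantCoeff g ≠ 0 := by
    intro e
    rw [hg, Derivation.leibniz] at hJ0
    simp [e] at hJ0
  have hy : y₁ ≠ 0 := fun h => by simpa [h] using pderiv_one_y₁
  have key : x * (x * pderiv ℂ 0 g + y₁ * pderiv ℂ 1 g) =
      (normalCoeff q - normalCoeff p) * g := by
    rw [← normalForm_apply_of_euler_eq_zero p hgE]
    rw [hg, Derivation.leibniz, normalForm_y₁] at h1
    simp only [smul_eq_mul] at h1
    refine mul_left_cancel₀ hy ?_
    linear_combination h1
  have hdiff : normalCoeff q - normalCoeff p =
      x * MvPowerSeries.C (q.2.1.1.1 - p.2.1.1.1) - (atV q.2.2 - atV p.2.2) := by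
    rw [normalCoeff, normalCoeff, hpq, map_sub]
    ring
  -- Reduce `key` modulo x and cancel the unit `g`.
  have hdvd : x ∣ atV q.2.2 - atV p.2.2 := by
    have hgu := isUnit_iff_constantCoeff_ne_zero.2 hg0
    rw [← hgu.dvd_mul_right]
    refine ⟨MvPowerSeries.C (q.2.1.1.1 - p.2.1.1.1) * g -
      (x * pderiv ℂ 0 g + y₁ * pderiv ℂ 1 g), ?_⟩
    rw [hdiff] at key
    linear_combination key
  have hcc : q.2.2 = p.2.2 := by
    refine Subtype.ext (PowerSeries.ext fun j => ?_)
    have := MvPowerSeries.X_dvd_iff.1 hdvd (diagExp j) (by simp)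
    rwa [map_sub, coeff_diagExp_atV, coeff_diagExp_atV, sub_eq_zero] at this
  have ha : q.2.1.1.1 = p.2.1.1.1 := by
    rw [hdiff, hcc, sub_self, sub_zero, mul_assoc] at key
    have := congrArg constantCoeff (mul_left_cancel₀ x_ne_zero key)
    simp only [map_add, map_mul, constantCoeff_x, constantCoeff_y₁, zero_mul, add_zero,
      MvPowerSeries.constantCoeff_C] at this
    exact sub_eq_zero.1 ((mul_eq_zero.1 this.symm).resolve_right hg0)
  have ha2 : q.2.1.1.2 = p.2.1.1.2 := by
    linear_combination q.2.1.2 - p.2.1.2 - ha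
  exact Prod.ext hpq (Prod.ext (Subtype.ext (Prod.ext ha ha2)) hcc)

theorem isSympConj_normalForm_iff (p q : Param) :
    IsSympConj (normalForm p) (normalForm q) ↔ q = p ∨ q = flip p := by
  constructor
  · intro h
    rcases eigenvalue_eq_or_eq_neg h with e | e
    · exact Or.inl (eq_of_isSympConj e h)
    · right
      have h' := isSympConj_equivalence.trans (isSympConj_equivalence.symm (isSympConj_flip p)) h
      exact eq_of_isSympConj (p := flip p) e h'
  · rintro (rfl | rfl)
    · exact isSympConj_equivalence.refl _
    · exact isSympConj_flip p

/-! ### The moduli space -/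

/-- The half-plane `-π/2 < arg λ ≤ π/2`. -/
def InHalfPlane (l : ℂ) : Prop := -(Real.pi / 2) < Complex.arg l ∧ Complex.arg l ≤ Real.pi / 2

theorem inHalfPlane_iff {l : ℂ} :
    InHalfPlane l ↔ (0 < l.re ∨ 0 ≤ l.im) ∧ (0 ≤ l.re ∨ l.im < 0) := by
  rw [InHalfPlane, Complex.neg_pi_div_two_lt_arg_iff, Complex.arg_le_pi_div_two_iff]

/-- The half-plane contains exactly one of each pair ±l: of its boundary it keeps the positive
imaginary ray and drops the negative one. -/
theorem inHalfPlane_neg_iff {l : ℂ} (hl : l ≠ 0) : InHalfPlane (-l) ↔ ¬ InHalfPlane l := by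
  have h : l.re ≠ 0 ∨ l.im ≠ 0 := by
    by_contra! h
    exact hl (Complex.ext h.1 h.2)
  rw [inHalfPlane_iff, inHalfPlane_iff, Complex.neg_re, Complex.neg_im]
  grind

theorem exists_sq_eq (μ : ℂˣ) : ∃ l : ℂˣ, l ^ 2 = μ ∧ InHalfPlane l := by
  obtain ⟨z, hz⟩ := IsAlgClosed.exists_pow_nat_eq (μ : ℂ) two_pos
  have hz0 : z ≠ 0 := fun h => μ.ne_zero (by rw [← hz, h]; simp)
  by_cases h : InHalfPlane z
  · exact ⟨Units.mk0 z hz0, Units.ext (by simpa using hz), h⟩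
  · exact ⟨-Units.mk0 z hz0, Units.ext (by simpa using hz), (inHalfPlane_neg_iff hz0).2 h⟩

theorem eq_of_sq_eq {l l' : ℂˣ} (h : l ^ 2 = l' ^ 2) (hl : InHalfPlane l) (hl' : InHalfPlane l') :
    l = l' := by
  have h' : (l : ℂ) ^ 2 = (l' : ℂ) ^ 2 := by exact_mod_cast congrArg Units.val h
  rcases sq_eq_sq_iff_eq_or_eq_neg.1 h' with e | e
  · exact Units.ext e
  · rw [e] at hl
    exact absurd hl' ((inHalfPlane_neg_iff l'.ne_zero).1 hl)

theorem exists_equiv_conjClass :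
    ∃ e : ConjClass ≃ ℂˣ × ResidueOne × VSeries,
      ∀ (Y : saddleNodes) (l : ℂˣ) (a : ResidueOne) (c : VSeries),
        -(Real.pi / 2) < Complex.arg (l : ℂ) → Complex.arg (l : ℂ) ≤ Real.pi / 2 →
        (e (Quotient.mk conjSetoid Y) = (l ^ 2, a, c) ↔
          IsSympConj Y.1 (normalForm (l, a, c))) := by
  -- The bijection is built backwards, from parameters to classes, with `s` the square root in the
  -- half-plane.
  choose s hs hs' using exists_sq_eq
  let f : ℂˣ × ResidueOne × VSeries → ConjClass := fun t =>
    Quotient.mk conjSetoid ⟨normalForm (s t.1, t.2), normalForm_mem_saddleNodes _⟩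
  have hf : ∀ (Y : saddleNodes) t, f t = Quotient.mk conjSetoid Y ↔
      IsSympConj Y.1 (normalForm (s t.1, t.2)) := fun Y t =>
    Quotient.eq.trans ⟨isSympConj_equivalence.symm, isSympConj_equivalence.symm⟩
  have hinj : Function.Injective f := by
    intro t t' h
    have h1 := (isSympConj_normalForm_iff _ _).1 (Quotient.exact h)
    rcases h1 with h1 | h1
    · obtain ⟨h2, h3⟩ := Prod.ext_iff.1 h1
      refine Prod.ext ?_ h3.symm
      rw [← hs t.1, ← hs t'.1]
      exact congrArg (· ^ 2) h2.symm
    -- The involution would place two opposite numbers in the half-plane.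
    · have h2 : s t'.1 = -s t.1 := congrArg Prod.fst h1
      have h3 := hs' t'.1
      rw [h2, Units.val_neg, inHalfPlane_neg_iff (s t.1).ne_zero] at h3
      exact absurd (hs' t.1) h3
  have hrep : ∀ p : Param, InHalfPlane p.1 → (s (p.1 ^ 2), p.2) = p := fun p hp =>
    Prod.ext (eq_of_sq_eq (hs _) (hs' _) hp) rfl
  have hsurj : Function.Surjective f := by
    intro C
    induction C using Quotient.inductionOn with | h Y => ?_
    obtain ⟨p, hp⟩ := exists_isSympConj_normalForm Y.2
    obtain ⟨p', hp', hh⟩ : ∃ p' : Param, IsSympConj Y.1 (normalForm p') ∧ InHalfPlane p'.1 := by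
      by_cases h : InHalfPlane p.1
      · exact ⟨p, hp, h⟩
      · exact ⟨flip p, isSympConj_equivalence.trans hp (isSympConj_flip p),
          (inHalfPlane_neg_iff p.1.ne_zero).2 h⟩
    refine ⟨(p'.1 ^ 2, p'.2), (hf _ _).2 ?_⟩
    rwa [hrep p' hh]
  refine ⟨(Equiv.ofBijective f ⟨hinj, hsurj⟩).symm, fun Y l a c h1 h2 => ?_⟩
  rw [Equiv.symm_apply_eq, eq_comm]
  refine (hf Y (l ^ 2, a, c)).trans ?_
  change IsSympConj Y.1 (normalForm (s (l ^ 2), (l, a, c).2)) ↔ _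
  rw [hrep (l, a, c) ⟨h1, h2⟩]

end

end SaddleNode

theorem mainTheorem5 :
    -- the normal forms are transversally Hamiltonian doubly-resonant saddle-nodes
    (∀ p : SaddleNode.Param, SaddleNode.normalForm p ∈ SaddleNode.saddleNodes) ∧
    -- every conjugacy class contains a normal form
    (∀ Y ∈ SaddleNode.saddleNodes,
      ∃ p : SaddleNode.Param, SaddleNode.IsSympConj Y (SaddleNode.normalForm p)) ∧
    -- two normal forms are conjugate iff their parameters are equal or exchanged by the involution
    (∀ p q : SaddleNode.Param,
      SaddleNode.IsSympConj (SaddleNode.normalForm p) (SaddleNode.normalForm q) ↔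
        q = p ∨ q = SaddleNode.flip p) ∧
    -- the conjugacy classes are in bijection with `ℂ^* × {a₁ + a₂ = 1} × vℂ⟦v⟧`, through the
    -- normal form whose `λ` satisfies `-π/2 < arg λ ≤ π/2`
    (∃ e : SaddleNode.ConjClass ≃ ℂˣ × SaddleNode.ResidueOne × SaddleNode.VSeries,
      ∀ (Y : SaddleNode.saddleNodes) (l : ℂˣ) (a : SaddleNode.ResidueOne)
        (c : SaddleNode.VSeries),
        -(Real.pi / 2) < Complex.arg (l : ℂ) → Complex.arg (l : ℂ) ≤ Real.pi / 2 →
        (e (Quotient.mk SaddleNode.conjSetoid Y) = (l ^ 2, a, c) ↔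
          SaddleNode.IsSympConj Y.1 (SaddleNode.normalForm (l, a, c)))) :=
  ⟨SaddleNode.normalForm_mem_saddleNodes, fun _ => SaddleNode.exists_isSympConj_normalForm,
    SaddleNode.isSympConj_normalForm_iff, SaddleNode.exists_equiv_conjClass⟩
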